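/- Let $M$ be a closed (compact, without boundary) smooth $3$-manifold with a smooth Riemannian metric (for example, a Riemannian $3$-sphere). Let $\Omega M$ be the space of closed piecewise $C^1$ curves $\gamma:[0,1]\to M$, $\gamma(0)=\gamma(1)$, let $\Omega_0M\subset\Omega M$ be the subspace of constant curves, and for $c\ge 0$ let $\Pi_cM$ be the space of piecewise smooth maps $[0,1]\to M$ of length at most $c$ (so $\Pi_0M$ consists of the constant curves); all these spaces carry the topology of uniform convergence. For $L\ge 0$, a $2$-sphere $\Sigma$ embedded in $M$ (a topological embedding suffices) is called $L$-short in $M$ if for every closed curve $\gamma\in\Omega M$ with image in $\Sigma$ there is a continuous family $\{\alpha_t\}_{t\in[0,1]}$ of piecewise smooth arcs $\alpha_t:[0,1]\to M$ of length at most $L$, not necessarily contained in $\Sigma$, such that $\alpha_t(0)=\gamma(0)$ and $\alpha_t(1)=\gamma(t)$ for all $t$, and $\alpha_0=\alpha_1$ is a constant curve. Let $K$ be a space homeomorphic to the closed disc $D^2$, let $\partial K$ be the subset corresponding to $\partial D^2$, and let $F:(K,\partial K)\to(\Omega M,\Omega_0M)$ be a continuous family of closed curves such that each $F(x)$, $x\in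 K$, lies on some $L$-short embedded $2$-sphere. Then for every $\delta>0$ there is a continuous map $$H:(K\times[0,1],\ \partial K\times[0,1])\to(\Pi_{5L+\delta}M,\ \Pi_0M)$$ such that for all $x\in K$ and $t\in[0,1]$: 1. $H(x,0)$ is the constant curve at $F(x)(0)$; 2. $H(x,t)(0)=F(x)(0)$ and $H(x,t)(1)=F(x)(t)$. In particular, each $H(x,1)$ is a closed curve of length at most $5L+\delta$; moreover, the family $x\mapsto H(x,1)$, $(K,\partial K)\to(\Omega M,\Omega_0M)$, is homotopic to $F$ through continuous maps $(K,\partial K)\to(\Omega M,\Omega_0M)$ that agree with $F$ on $\partial K$. -/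

import Mathlib

open Set Bundle
open scoped Manifold ContDiff Topology ENNReal NNReal unitInterval

/-- Euclidean space of dimension `n`. -/
abbrev Euc (n : ℕ) : Type := EuclideanSpace ℝ (Fin n)

section Curves

variable {M : Type*} [TopologicalSpace M] [ChartedSpace (Euc 3) M]

/-- The curve `γ : [0,1] → M` is piecewise of class `C^n`: there is a subdivision
`0 = t₀ ≤ t₁ ≤ … ≤ t_k = 1` such that `γ` is of class `C^n` on each closed interval
`[tᵢ, tᵢ₊₁]` (with one-sided derivatives at its ends). Outside of `[0,1]` the curve is extended
by constants; this extension plays no role. -/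
def IsPiecewiseContMDiff (n : ℕ∞) (γ : C(I, M)) : Prop :=
  ∃ (k : ℕ) (t : ℕ → ℝ), Monotone t ∧ t 0 = 0 ∧ t k = 1 ∧
    ∀ i < k, ContMDiffOn 𝓘(ℝ, ℝ) (𝓡 3) n (IccExtend zero_le_one γ) (Icc (t i) (t (i + 1)))

/-- The curve is constant. -/
def IsConstantCurve (γ : C(I, M)) : Prop := ∃ p : M, γ = ContinuousMap.const I p

variable (M) in
/-- The free loop space `ΩM`: closed, piecewise `C^1` curves in `M`. Like all spaces of curves here,
it carries the compact-open topology (uniform convergence), inherited from `C(I, M)`. -/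
def loopSpace : Set C(I, M) := {γ | γ 0 = γ 1 ∧ IsPiecewiseContMDiff 1 γ}

variable [RiemannianBundle (fun x : M ↦ TangentSpace (𝓡 3) x)]

/-- The Riemannian length `∫₀¹ ‖γ'(t)‖ dt` of a (piecewise differentiable) curve. -/
noncomputable def curveLength (γ : C(I, M)) : ℝ≥0∞ :=
  Manifold.pathELength (𝓡 3) (IccExtend zero_le_one γ) 0 1

variable (M) in
/-- The space `Π_c M` of piecewise smooth arcs in `M` of length at most `c`. -/
def arcSpace (c : ℝ≥0) : Set C(I, M) := {γ | IsPiecewiseContMDiff ⊤ γ ∧ curveLength γ ≤ c}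

/-- `S` is `L`-short in `M`: for every closed (piecewise `C^1`) curve `γ` in `S` there is a
continuous family `α_t`, `t ∈ [0,1]`, of piecewise smooth arcs in `M` of length at most `L`, such
that `α_t` joins `γ 0` to `γ t`, and `α_0 = α_1` is a constant curve. -/
def IsLShort (L : ℝ≥0) (S : Set M) : Prop :=
  ∀ γ ∈ loopSpace M, range γ ⊆ S →
    ∃ α : C(I, C(I, M)),
      (∀ t, α t ∈ arcSpace M L) ∧
      (∀ t, α t 0 = γ 0) ∧
      (∀ t, α t 1 = γ t) ∧
      IsConstantCurve (α 0) ∧ α 0 = α 1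

end Curves

/-- `S` is an embedded 2-sphere in `M`, that is, the image of a topological embedding of the
2-sphere. -/
def IsEmbeddedTwoSphere {M : Type*} [TopologicalSpace M] (S : Set M) : Prop :=
  ∃ f : Metric.sphere (0 : Euc 3) 1 → M, Topology.IsEmbedding f ∧ range f = S

/-- The boundary `∂K` of a space `K` identified by `e` with the closed unit disc of the plane. -/
def discBoundary {K : Type*} [TopologicalSpace K] (e : K ≃ₜ Metric.closedBall (0 : Euc 2) 1) :
    Set K :=
  {x | ‖(e x : Euc 2)‖ = 1}

/-! Each curve `F ξ` has arcs `α t` of length at most `L` from its base point to its points, but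
these need not vary continuously with `ξ`. For `x` near `ξ`, a short jump from `F x t` to `F ξ t`
followed by `α t` backwards joins every point of `F x` to the common point `F ξ 0`. Going in along
one such arc and out along another connects `F x r` to `F x r'`, at a cost of about `2L`, or only
`L` when `r = 0`, because `α 0` is constant. To make this connection continuous and constant for `r
= r'`, the arcs are followed only up to a parameter controlled by `|r - r'|`, and a short path
bridges the gap (`exists_connecting_arcs`).

The local choices of `ξ` are reconciled by dimension theory rather than by comparing them. The disc
lies in the plane, so it has a fine cover by three families of pairwise disjoint open sets
(`exists_three_coloring`). The interval from `0` to `t` is cut into three consecutive parts, one for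
each colour, and a part degenerates near every point outside the sets of its colour. Since the
connecting arcs of a degenerate part are constant, each colour only ever uses one `ξ` at a time and
the result is continuous (`continuous_gluedArcs`). The first part costs `L`, the other two `2L`
each, whence `5L`.

Near the boundary the curves are almost constant. There the construction runs only up to a stopping
time that vanishes on the boundary, and one more short path reaches the required end point. -/

/-! ### Piecewise smooth curves and their lengths under affine reparametrization -/

section PiecewiseSmooth

variable {M : Type*} [TopologicalSpace M] [ChartedSpace (Euc 3) M]

/-- The curve `γ : ℝ → M` is piecewise of class `C^n` on the interval `[a, b]`. -/
inductive PiecewiseContMDiffOn (n : ℕ∞) (γ : ℝ → M) : ℝ → ℝ → Prop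
  | smooth {a b : ℝ} (hab : a ≤ b) (h : ContMDiffOn 𝓘(ℝ, ℝ) (𝓡 3) n γ (Icc a b)) :
      PiecewiseContMDiffOn n γ a b
  | trans {a b c : ℝ} (hab : PiecewiseContMDiffOn n γ a b) (hbc : PiecewiseContMDiffOn n γ b c) :
      PiecewiseContMDiffOn n γ a c

namespace PiecewiseContMDiffOn

variable {n : ℕ∞} {γ γ' : ℝ → M} {a b a' b' : ℝ}

theorem le (h : PiecewiseContMDiffOn n γ a b) : a ≤ b := by
  induction h with
  | smooth hab _ => exact hab
  | trans _ _ h₁ h₂ => exact h₁.trans h₂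

theorem congr (h : PiecewiseContMDiffOn n γ a b) (hγ : EqOn γ' γ (Icc a b)) :
    PiecewiseContMDiffOn n γ' a b := by
  induction h with
  | smooth hab h => exact .smooth hab (h.congr hγ)
  | trans hab hbc h₁ h₂ =>
    exact .trans (h₁ (hγ.mono (Icc_subset_Icc_right hbc.le)))
      (h₂ (hγ.mono (Icc_subset_Icc_left hab.le)))

theorem mono (h : PiecewiseContMDiffOn n γ a b) (ha : a ≤ a') (hab : a' ≤ b') (hb : b' ≤ b) :
    PiecewiseContMDiffOn n γ a' b' := by
  induction h generalizing a' b' with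
  | smooth _ h => exact .smooth hab (h.mono (Icc_subset_Icc ha hb))
  | @trans a b c _ _ h₁ h₂ =>
    rcases le_total b' b with h | h
    · exact h₁ ha hab h
    rcases le_total a' b with h' | h'
    · exact .trans (h₁ ha h' le_rfl) (h₂ le_rfl h hb)
    · exact h₂ h' hab hb

theorem of_le {m : ℕ∞} (h : PiecewiseContMDiffOn n γ a b) (hmn : m ≤ n) :
    PiecewiseContMDiffOn m γ a b := by
  induction h with
  | smooth hab h => exact .smooth hab (h.of_le (by exact_mod_cast hmn))
  | trans _ _ h₁ h₂ => exact .trans h₁ h₂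

theorem const (p : M) (hab : a ≤ b) : PiecewiseContMDiffOn n (fun _ ↦ p) a b :=
  .smooth hab contMDiffOn_const

theorem comp_mul_add {m k : ℝ} (hm : 0 < m) (h : PiecewiseContMDiffOn n γ (m * a + k) (m * b + k)) :
    PiecewiseContMDiffOn n (fun s ↦ γ (m * s + k)) a b := by
  -- The induction needs end points that are variables, so the affine map is moved to the other
  -- side.
  suffices H : ∀ a b, PiecewiseContMDiffOn n γ a b →
      PiecewiseContMDiffOn n (fun s ↦ γ (m * s + k)) ((a - k) / m) ((b - k) / m) by
    have := H _ _ h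
    rwa [add_sub_cancel_right, add_sub_cancel_right, mul_div_cancel_left₀ _ hm.ne',
      mul_div_cancel_left₀ _ hm.ne'] at this
  intro a b h
  induction h with
  | @smooth a b hab h =>
    refine .smooth (by gcongr) (h.comp (t := Icc a b) (f := fun s : ℝ ↦ m * s + k) ?_ ?_)
    · exact ContDiff.contMDiff (by fun_prop) |>.contMDiffOn
    · intro s hs
      rw [mem_Icc, div_le_iff₀ hm, le_div_iff₀ hm] at hs
      exact ⟨by linarith, by linarith⟩
  | trans _ _ h₁ h₂ => exact .trans h₁ h₂

theorem comp_one_sub (h : PiecewiseContMDiffOn n γ a b) :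
    PiecewiseContMDiffOn n (fun s ↦ γ (1 - s)) (1 - b) (1 - a) := by
  induction h with
  | @smooth a b hab h =>
    refine .smooth (by linarith) (h.comp (t := Icc a b) (f := fun s : ℝ ↦ 1 - s) ?_ ?_)
    · exact ContDiff.contMDiff (by fun_prop) |>.contMDiffOn
    · intro s hs
      exact ⟨by linarith [hs.2], by linarith [hs.1]⟩
  | trans _ _ h₁ h₂ => exact .trans h₂ h₁

theorem exists_subdivision (h : PiecewiseContMDiffOn n γ a b) :
    ∃ (k : ℕ) (t : ℕ → ℝ), Monotone t ∧ t 0 = a ∧ t k = b ∧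
      ∀ i < k, ContMDiffOn 𝓘(ℝ, ℝ) (𝓡 3) n γ (Icc (t i) (t (i + 1))) := by
  induction h with
  | @smooth a b hab h =>
    refine ⟨1, fun i ↦ if i = 0 then a else b, ?_, by simp, by simp, ?_⟩
    · refine monotone_nat_of_le_succ fun i ↦ ?_
      rcases i with _ | i <;> simp [hab]
    · intro i hi
      obtain rfl : i = 0 := by omega
      simpa using h
  | trans _ _ h₁ h₂ =>
    obtain ⟨k, t, ht, h0, hk, hs⟩ := h₁
    obtain ⟨k', t', ht', h0', hk', hs'⟩ := h₂
    refine ⟨k + k', fun i ↦ if i ≤ k then t i else t' (i - k), ?_, by simpa using h0, ?_, ?_⟩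
    · refine monotone_nat_of_le_succ fun i ↦ ?_
      rcases lt_trichotomy i k with h | rfl | h
      · simpa [h.le, Nat.succ_le_of_lt h] using ht i.le_succ
      · simpa [hk, ← h0'] using ht' zero_le_one
      · simpa [h.not_ge, show ¬ i + 1 ≤ k by omega] using ht' (by omega)
    · rcases Nat.eq_zero_or_pos k' with rfl | h
      · simp [hk, ← hk', h0']
      · simp [show ¬ k + k' ≤ k by omega, hk']
    · intro i hi
      rcases lt_or_ge i k with h | h
      · simpa [h.le, Nat.succ_le_of_lt h] using hs i h
      · obtain ⟨j, rfl⟩ := Nat.exists_eq_add_of_le h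
        have h₁ : (if k + j ≤ k then t (k + j) else t' (k + j - k)) = t' j := by
          rcases Nat.eq_zero_or_pos j with rfl | hj
          · simp [hk, h0']
          · simp [show ¬ k + j ≤ k by omega]
        have h₂ : (if k + j + 1 ≤ k then t (k + j + 1) else t' (k + j + 1 - k)) = t' (j + 1) := by
          rw [if_neg (by omega)]
          congr 1
          omega
        simp only [h₁, h₂]
        exact hs' j (by omega)

end PiecewiseContMDiffOn

/-- The inductive form turns closure and length statements into inductions over the pieces, without
subdivisions to merge. -/
theorem isPiecewiseContMDiff_iff {n : ℕ∞} {γ : C(I, M)} :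
    IsPiecewiseContMDiff n γ ↔ PiecewiseContMDiffOn n (IccExtend zero_le_one γ) 0 1 := by
  refine ⟨?_, fun h ↦ h.exists_subdivision⟩
  rintro ⟨k, t, ht, h0, hk, h⟩
  have H : ∀ j < k, PiecewiseContMDiffOn n (IccExtend zero_le_one γ) (t 0) (t (j + 1)) := by
    intro j
    induction j with
    | zero => exact fun hj ↦ .smooth (ht zero_le_one) (h 0 hj)
    | succ j ih =>
      exact fun hj ↦ .trans (ih (by omega)) (.smooth (ht (j + 1).le_succ) (h (j + 1) hj))
  rcases k with _ | k
  · rw [h0] at hk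
    exact absurd hk zero_ne_one
  · simpa [h0, hk] using H k k.lt_succ_self

theorem IsPiecewiseContMDiff.of_le {m n : ℕ∞} {γ : C(I, M)} (h : IsPiecewiseContMDiff n γ)
    (hmn : m ≤ n) : IsPiecewiseContMDiff m γ :=
  isPiecewiseContMDiff_iff.2 ((isPiecewiseContMDiff_iff.1 h).of_le hmn)

section Length

variable [RiemannianBundle (fun x : M ↦ TangentSpace (𝓡 3) x)] {n : ℕ∞} {γ γ' : ℝ → M} {a b : ℝ}

open Manifold

theorem PiecewiseContMDiffOn.pathELength_comp_mul_add {m k : ℝ} (hn : 1 ≤ n) (hm : 0 < m)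
    (h : PiecewiseContMDiffOn n γ (m * a + k) (m * b + k)) :
    pathELength (𝓡 3) (fun s ↦ γ (m * s + k)) a b =
      pathELength (𝓡 3) γ (m * a + k) (m * b + k) := by
  suffices H : ∀ a b, PiecewiseContMDiffOn n γ a b →
      pathELength (𝓡 3) (fun s ↦ γ (m * s + k)) ((a - k) / m) ((b - k) / m) =
        pathELength (𝓡 3) γ a b by
    have := H _ _ h
    rwa [add_sub_cancel_right, add_sub_cancel_right, mul_div_cancel_left₀ _ hm.ne',
      mul_div_cancel_left₀ _ hm.ne'] at this
  intro a b h
  induction h with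
  | @smooth a b hab h =>
    have e (c : ℝ) : m * ((c - k) / m) + k = c := by field_simp; ring
    have := pathELength_comp_of_monotoneOn (M := M) (H := Euc 3) (E := Euc 3) (γ := γ) (f := fun s : ℝ ↦ m * s + k)
      (a := (a - k) / m) (b := (b - k) / m) (by gcongr)
      (fun s _ t _ hst ↦ by dsimp only; gcongr) (by fun_prop)
      (by
        simp only [e]
        refine h.mdifferentiableOn (by exact_mod_cast (zero_lt_one.trans_le hn).ne'))
    simpa only [e, Function.comp_def] using this
  | trans hab hbc h₁ h₂ =>
    rw [← pathELength_add (b := (_ - k) / m) _ _, h₁, h₂, pathELength_add hab.le hbc.le]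
    · have := hab.le
      gcongr
    · have := hbc.le
      gcongr

theorem PiecewiseContMDiffOn.pathELength_comp_one_sub (hn : 1 ≤ n)
    (h : PiecewiseContMDiffOn n γ a b) :
    pathELength (𝓡 3) (fun s ↦ γ (1 - s)) (1 - b) (1 - a) = pathELength (𝓡 3) γ a b := by
  induction h with
  | @smooth a b hab h =>
    have := pathELength_comp_of_antitoneOn (M := M) (H := Euc 3) (E := Euc 3) (γ := γ) (f := fun s : ℝ ↦ 1 - s)
      (a := 1 - b) (b := 1 - a) (by linarith)
      (fun s _ t _ hst ↦ by dsimp only; linarith) (by fun_prop)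
      (by
        simp only [sub_sub_cancel]
        refine h.mdifferentiableOn (by exact_mod_cast (zero_lt_one.trans_le hn).ne'))
    simpa only [sub_sub_cancel, Function.comp_def] using this
  | @trans a b c hab hbc h₁ h₂ =>
    rw [← pathELength_add (b := 1 - b) (by linarith [hbc.le]) (by linarith [hab.le]), h₁, h₂,
      add_comm, pathELength_add hab.le hbc.le]

end Length

end PiecewiseSmooth

/-! ### Concatenation, reversal and initial parts of curves -/

section CurveOperations

variable {X : Type*} [TopologicalSpace X]

/-- The concatenation of two curves; a junk value if they do not match. -/
noncomputable def curveConcat (γ₁ γ₂ : C(I, X)) : C(I, X) :=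
  open Classical in
  if h : γ₁ 1 = γ₂ 0 then
    ((⟨γ₁, rfl, rfl⟩ : Path (γ₁ 0) (γ₁ 1)).trans ⟨γ₂, h.symm, rfl⟩ : Path (γ₁ 0) (γ₂ 1))
  else γ₁

/-- The reversed curve. -/
def curveRev (γ : C(I, X)) : C(I, X) := γ.comp ⟨unitInterval.symm, by fun_prop⟩

/-- The initial part of a curve, up to the parameter `l`. -/
def curveInit (γ : C(I, X)) (l : I) : C(I, X) := γ.comp ⟨fun s ↦ l * s, by fun_prop⟩

@[simp] theorem curveRev_apply (γ : C(I, X)) (s : I) :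
    curveRev γ s = γ (unitInterval.symm s) := rfl

@[simp] theorem curveInit_apply (γ : C(I, X)) (l s : I) : curveInit γ l s = γ (l * s) := rfl

theorem curveInit_zero (γ : C(I, X)) : curveInit γ 0 = ContinuousMap.const I (γ 0) := by
  ext s
  simp

theorem curveRev_const (p : X) :
    curveRev (ContinuousMap.const I p) = ContinuousMap.const I p := rfl

theorem curveConcat_apply {γ₁ γ₂ : C(I, X)} (h : γ₁ 1 = γ₂ 0) (s : I) :
    curveConcat γ₁ γ₂ s = if (s : ℝ) ≤ 1 / 2 then IccExtend zero_le_one γ₁ (2 * s)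
      else IccExtend zero_le_one γ₂ (2 * s - 1) := by
  rw [curveConcat, dif_pos h]
  rfl

theorem curveConcat_zero {γ₁ γ₂ : C(I, X)} (h : γ₁ 1 = γ₂ 0) : curveConcat γ₁ γ₂ 0 = γ₁ 0 := by
  simp [curveConcat, dif_pos h]

theorem curveConcat_one {γ₁ γ₂ : C(I, X)} (h : γ₁ 1 = γ₂ 0) : curveConcat γ₁ γ₂ 1 = γ₂ 1 := by
  simp [curveConcat, dif_pos h]

theorem curveConcat_const (p : X) :
    curveConcat (ContinuousMap.const I p) (ContinuousMap.const I p) = ContinuousMap.const I p := by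
  ext s
  rw [curveConcat_apply rfl]
  simp [IccExtend]

/-- The summand `0` puts the reparametrization into the form `m * s + k` of `comp_mul_add`. -/
theorem IccExtend_curveConcat_left {γ₁ γ₂ : C(I, X)} (h : γ₁ 1 = γ₂ 0) :
    EqOn (IccExtend zero_le_one (curveConcat γ₁ γ₂))
      (fun s ↦ IccExtend zero_le_one γ₁ (2 * s + 0)) (Icc 0 (1 / 2)) := by
  intro s hs
  have hs' : s ∈ I := ⟨hs.1, hs.2.trans (by norm_num)⟩
  rw [IccExtend_of_mem _ _ hs', curveConcat_apply h, if_pos hs.2]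
  simp only [add_zero]

theorem IccExtend_curveConcat_right {γ₁ γ₂ : C(I, X)} (h : γ₁ 1 = γ₂ 0) :
    EqOn (IccExtend zero_le_one (curveConcat γ₁ γ₂))
      (fun s ↦ IccExtend zero_le_one γ₂ (2 * s + (-1))) (Icc (1 / 2) 1) := by
  intro s hs
  have hs' : s ∈ I := ⟨le_trans (by norm_num) hs.1, hs.2⟩
  rw [IccExtend_of_mem _ _ hs', curveConcat_apply h]
  split_ifs with h'
  · obtain rfl : s = 1 / 2 := le_antisymm h' hs.1
    simp only [IccExtend, Function.comp_apply]
    norm_num [projIcc]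
    exact h
  · rfl

theorem IccExtend_curveRev (γ : C(I, X)) :
    EqOn (IccExtend zero_le_one (curveRev γ)) (fun s ↦ IccExtend zero_le_one γ (1 - s)) I := by
  intro s hs
  have hs' : 1 - s ∈ I := ⟨by linarith [hs.2], by linarith [hs.1]⟩
  simp only [IccExtend_of_mem _ _ hs, IccExtend_of_mem _ _ hs']
  rfl

theorem IccExtend_curveInit (γ : C(I, X)) (l : I) :
    EqOn (IccExtend zero_le_one (curveInit γ l))
      (fun s ↦ IccExtend zero_le_one γ (l * s + 0)) I := by
  intro s hs
  have hs' : l * s ∈ I := unitInterval.mul_mem l.2 hs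
  simp only [add_zero, IccExtend_of_mem _ _ hs, IccExtend_of_mem _ _ hs']
  rfl

variable {Y : Type*} [TopologicalSpace Y]

theorem Continuous.curveConcat {f g : Y → C(I, X)} (hf : Continuous f) (hg : Continuous g)
    (h : ∀ y, f y 1 = g y 0) : Continuous fun y ↦ curveConcat (f y) (g y) := by
  refine ContinuousMap.continuous_of_continuous_uncurry _ ?_
  have : (Function.uncurry fun y s ↦ _root_.curveConcat (f y) (g y) s) = fun p : Y × I ↦
      if (p.2 : ℝ) ≤ 1 / 2 then f p.1 (projIcc 0 1 zero_le_one (2 * p.2))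
      else g p.1 (projIcc 0 1 zero_le_one (2 * p.2 - 1)) := by
    ext p
    exact curveConcat_apply (h p.1) p.2
  change Continuous (Function.uncurry fun y s ↦ _root_.curveConcat (f y) (g y) s)
  rw [this]
  refine Continuous.if_le ?_ ?_ (by fun_prop) continuous_const ?_
  · fun_prop
  · fun_prop
  · intro p hp
    rw [hp]
    norm_num [projIcc]
    exact h p.1

theorem ContinuousOn.curveConcat {f g : Y → C(I, X)} {s : Set Y} (hf : ContinuousOn f s)
    (hg : ContinuousOn g s) (h : ∀ y ∈ s, f y 1 = g y 0) :
    ContinuousOn (fun y ↦ curveConcat (f y) (g y)) s := by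
  rw [continuousOn_iff_continuous_domRestrict] at *
  exact hf.curveConcat hg fun y ↦ h y y.2

theorem continuous_curveRev : Continuous (curveRev : C(I, X) → C(I, X)) :=
  ContinuousMap.continuous_precomp _

theorem continuous_curveInit : Continuous fun p : C(I, X) × I ↦ curveInit p.1 p.2 := by
  refine ContinuousMap.continuous_of_continuous_uncurry _ ?_
  change Continuous fun q : (C(I, X) × I) × I ↦ q.1.1 (q.1.2 * q.2)
  fun_prop

end CurveOperations

/-! ### Smoothness and length under these operations -/

section Arcs

variable {M : Type*} [TopologicalSpace M] [ChartedSpace (Euc 3) M]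

theorem IsPiecewiseContMDiff.const (n : ℕ∞) (p : M) :
    IsPiecewiseContMDiff n (ContinuousMap.const I p) :=
  isPiecewiseContMDiff_iff.2 (.const p zero_le_one)

theorem IsPiecewiseContMDiff.curveConcat {n : ℕ∞} {γ₁ γ₂ : C(I, M)}
    (h₁ : IsPiecewiseContMDiff n γ₁) (h₂ : IsPiecewiseContMDiff n γ₂) (h : γ₁ 1 = γ₂ 0) :
    IsPiecewiseContMDiff n (curveConcat γ₁ γ₂) := by
  rw [isPiecewiseContMDiff_iff] at *
  refine .trans (b := 1 / 2) (.congr (.comp_mul_add two_pos ?_) (IccExtend_curveConcat_left h))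
    (.congr (.comp_mul_add two_pos ?_) (IccExtend_curveConcat_right h))
  · norm_num
    exact h₁
  · norm_num
    exact h₂

theorem IsPiecewiseContMDiff.curveRev {n : ℕ∞} {γ : C(I, M)} (h : IsPiecewiseContMDiff n γ) :
    IsPiecewiseContMDiff n (curveRev γ) := by
  rw [isPiecewiseContMDiff_iff] at *
  refine .congr ?_ (IccExtend_curveRev γ)
  simpa using h.comp_one_sub

theorem IsPiecewiseContMDiff.curveInit {n : ℕ∞} {γ : C(I, M)} (h : IsPiecewiseContMDiff n γ)
    (l : I) : IsPiecewiseContMDiff n (curveInit γ l) := by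
  rcases eq_or_ne l 0 with rfl | hl
  · rw [curveInit_zero]
    exact .const n _
  rw [isPiecewiseContMDiff_iff] at *
  refine .congr (.comp_mul_add (unitInterval.pos_iff_ne_zero.2 hl) ?_) (IccExtend_curveInit γ l)
  exact h.mono (by simp) (by simpa using l.2.1) (by simpa using l.2.2)

variable [RiemannianBundle (fun x : M ↦ TangentSpace (𝓡 3) x)]

open Manifold

theorem arcSpace_mono {c d : ℝ≥0} (h : c ≤ d) : arcSpace M c ⊆ arcSpace M d :=
  fun _ hγ ↦ ⟨hγ.1, hγ.2.trans (by exact_mod_cast h)⟩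

theorem const_mem_arcSpace (p : M) (c : ℝ≥0) : ContinuousMap.const I p ∈ arcSpace M c := by
  refine ⟨.const ⊤ p, ?_⟩
  have : IccExtend zero_le_one (ContinuousMap.const I p) = fun _ : ℝ ↦ p := rfl
  rw [curveLength, this, pathELength_eq_lintegral_mfderiv_Icc]
  simp [mfderiv_const]

theorem curveConcat_mem_arcSpace {c₁ c₂ : ℝ≥0} {γ₁ γ₂ : C(I, M)} (h₁ : γ₁ ∈ arcSpace M c₁)
    (h₂ : γ₂ ∈ arcSpace M c₂) (h : γ₁ 1 = γ₂ 0) : curveConcat γ₁ γ₂ ∈ arcSpace M (c₁ + c₂) := by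
  refine ⟨h₁.1.curveConcat h₂.1 h, ?_⟩
  have h₁' := isPiecewiseContMDiff_iff.1 h₁.1
  have h₂' := isPiecewiseContMDiff_iff.1 h₂.1
  rw [curveLength, ← pathELength_add (b := 1 / 2) (by norm_num) (by norm_num),
    pathELength_congr (IccExtend_curveConcat_left h),
    pathELength_congr (IccExtend_curveConcat_right h),
    PiecewiseContMDiffOn.pathELength_comp_mul_add (n := ⊤) le_top two_pos (by norm_num; exact h₁'),
    PiecewiseContMDiffOn.pathELength_comp_mul_add (n := ⊤) le_top two_pos (by norm_num; exact h₂')]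
  norm_num
  exact add_le_add h₁.2 h₂.2

theorem curveRev_mem_arcSpace {c : ℝ≥0} {γ : C(I, M)} (h : γ ∈ arcSpace M c) :
    curveRev γ ∈ arcSpace M c := by
  refine ⟨h.1.curveRev, ?_⟩
  have := (isPiecewiseContMDiff_iff.1 h.1).pathELength_comp_one_sub le_top
  rw [sub_self, sub_zero] at this
  rw [curveLength, pathELength_congr (IccExtend_curveRev γ), this]
  exact h.2

theorem curveInit_mem_arcSpace {c : ℝ≥0} {γ : C(I, M)} (h : γ ∈ arcSpace M c) (l : I) :
    curveInit γ l ∈ arcSpace M c := by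
  rcases eq_or_ne l 0 with rfl | hl
  · rw [curveInit_zero]
    exact const_mem_arcSpace _ _
  refine ⟨h.1.curveInit l, ?_⟩
  rw [curveLength, pathELength_congr (IccExtend_curveInit γ l),
    PiecewiseContMDiffOn.pathELength_comp_mul_add (n := ⊤) le_top
      (unitInterval.pos_iff_ne_zero.2 hl)]
  · exact (pathELength_mono (by simp) (by simpa using l.2.2)).trans h.2
  · exact (isPiecewiseContMDiff_iff.1 h.1).mono (by simp) (by simpa using l.2.1)
      (by simpa using l.2.2)

end Arcs

/-! ### Lengths of straight segments in a chart -/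

section ChartSegments

open Manifold MeasureTheory

variable {E : Type*} [NormedAddCommGroup E] [NormedSpace ℝ E]
  {H : Type*} [TopologicalSpace H] {J : ModelWithCorners ℝ E H}
  {M : Type*} [TopologicalSpace M] [ChartedSpace H M]
  [RiemannianBundle (fun x : M ↦ TangentSpace J x)]
  [IsManifold J 1 M] [IsContinuousRiemannianBundle E (fun x : M ↦ TangentSpace J x)]

attribute [local instance] normedAddCommGroupTangentSpaceVectorSpace
attribute [local instance] normedSpaceTangentSpaceVectorSpace

variable (J) in
/-- Near each point, the preimages of segments under a chart have length bounded by a multiple of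
the length of the segment. -/
theorem exists_pathELength_extChartAt_symm_lineMap_le (x : M) :
    ∃ C > (0 : ℝ≥0), ∃ r > 0, Metric.ball (extChartAt J x x) r ∩ range J ⊆ (extChartAt J x).target ∧
      ∀ y ∈ Metric.ball (extChartAt J x x) r ∩ range J,
        ∀ z ∈ Metric.ball (extChartAt J x x) r ∩ range J,
        pathELength J ((extChartAt J x).symm ∘ AffineMap.lineMap (k := ℝ) y z) 0 1 ≤
          C * edist y z := by
  obtain ⟨C, C_pos, hC⟩ := eventually_enorm_mfderivWithin_symm_extChartAt_lt J x
  replace hC : ∀ᶠ y in 𝓝[range J] (extChartAt J x x), ∀ v : E,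
      ‖mfderivWithin 𝓘(ℝ, E) J (extChartAt J x).symm (range J) y v‖ₑ ≤ C * ‖v‖ₑ := by
    filter_upwards [hC] with y hy v
    exact (ContinuousLinearMap.le_opENorm _ v).trans (mul_le_mul' hy.le le_rfl)
  obtain ⟨r, r_pos, hr⟩ : ∃ r > 0,
      Metric.ball (extChartAt J x x) r ∩ range J ⊆ (extChartAt J x).target ∩
        {y | ∀ v : E,
          ‖mfderivWithin 𝓘(ℝ, E) J (extChartAt J x).symm (range J) y v‖ₑ ≤ C * ‖v‖ₑ} :=
    Metric.mem_nhdsWithin_iff.1 (Filter.inter_mem (extChartAt_target_mem_nhdsWithin x) hC)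
  refine ⟨C, C_pos, r, r_pos, fun y hy ↦ (hr hy).1, fun y hy z hz ↦ ?_⟩
  set η : ℝ → E := ⇑(AffineMap.lineMap (k := ℝ) y z) with hη_def
  -- By convexity the whole segment stays where the derivative of the inverse chart is bounded by
  -- `C`.
  have hη : Icc 0 1 ⊆ η ⁻¹' ((extChartAt J x).target ∩
      {y | ∀ v : E,
        ‖mfderivWithin 𝓘(ℝ, E) J (extChartAt J x).symm (range J) y v‖ₑ ≤ C * ‖v‖ₑ}) := by
    rw [← image_subset_iff, hη_def, ← segment_eq_image_lineMap]
    exact (((convex_ball _ _).inter J.convex_range).segment_subset hy hz).trans hr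
  have hη' (t : ℝ) : HasDerivAt η (z - y) t := AffineMap.hasDerivAt_lineMap
  have key : ∀ t ∈ Icc (0 : ℝ) 1,
      ‖mfderivWithin 𝓘(ℝ, ℝ) J ((extChartAt J x).symm ∘ η) (Icc 0 1) t 1‖ₑ ≤ C * edist y z := by
    intro t ht
    have h₁ : mfderivWithin 𝓘(ℝ, ℝ) J ((extChartAt J x).symm ∘ η) (Icc 0 1) t =
        (mfderivWithin 𝓘(ℝ, E) J (extChartAt J x).symm (range J) (η t)) ∘L
          (mfderivWithin 𝓘(ℝ, ℝ) 𝓘(ℝ, E) η (Icc 0 1) t) := by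
      apply mfderivWithin_comp
      · exact mdifferentiableWithinAt_extChartAt_symm (hη ht).1
      · exact (hη' t).differentiableAt.mdifferentiableAt.mdifferentiableWithinAt
      · exact fun s hs ↦ extChartAt_target_subset_range x (hη hs).1
      · rw [uniqueMDiffWithinAt_iff_uniqueDiffWithinAt]
        exact uniqueDiffOn_Icc zero_lt_one t ht
    have h₂ : mfderivWithin 𝓘(ℝ, ℝ) J ((extChartAt J x).symm ∘ η) (Icc 0 1) t 1 =
        (mfderivWithin 𝓘(ℝ, E) J (extChartAt J x).symm (range J) (η t))
          (mfderivWithin 𝓘(ℝ, ℝ) 𝓘(ℝ, E) η (Icc 0 1) t 1) := congr($h₁ 1)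
    have h₃ : mfderivWithin 𝓘(ℝ, ℝ) 𝓘(ℝ, E) η (Icc 0 1) t 1 = (z - y : E) := by
      rw [mfderivWithin_eq_fderivWithin,
        ((hη' t).hasDerivWithinAt.hasFDerivWithinAt).fderivWithin
          (uniqueDiffOn_Icc zero_lt_one t ht)]
      exact one_smul ℝ (z - y)
    rw [h₂, h₃, edist_comm, edist_eq_enorm_sub]
    exact (hη ht).2 (z - y)
  rw [pathELength_eq_lintegral_mfderivWithin_Icc]
  calc _ ≤ ∫⁻ _ in Icc (0 : ℝ) 1, C * edist y z := setLIntegral_mono' measurableSet_Icc key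
    _ = C * edist y z := by simp

end ChartSegments

/-! ### Continuous choice of short paths between nearby points -/

section ShortPaths

variable {M : Type*} [TopologicalSpace M] [ChartedSpace (Euc 3) M]
  [RiemannianBundle (fun x : M ↦ TangentSpace (𝓡 3) x)]

/-- Sufficiently close points `p`, `q` are the initial point of, and for `q ∈ A` joined by, an arc
of length at most `c` that depends continuously on `p` and `q` and is constant for `p = q`. -/
def HasShortPaths (c : ℝ≥0) (A : Set M) : Prop :=
  ∃ (W : Set (M × M)) (G : M × M → C(I, M)), IsOpen W ∧ (∀ p, (p, p) ∈ W) ∧ ContinuousOn G W ∧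
    (∀ w ∈ W, G w ∈ arcSpace M c) ∧ (∀ w ∈ W, G w 0 = w.1) ∧
    (∀ p, G (p, p) = ContinuousMap.const I p) ∧ ∀ w ∈ W, w.2 ∈ A → G w 1 = w.2

theorem HasShortPaths.empty (c : ℝ≥0) : HasShortPaths c (∅ : Set M) :=
  ⟨univ, fun w ↦ ContinuousMap.const I w.1, isOpen_univ, fun _ ↦ mem_univ _,
    (ContinuousMap.continuous_const'.comp continuous_fst).continuousOn,
    fun _ _ ↦ const_mem_arcSpace _ _, fun _ _ ↦ rfl, fun _ ↦ rfl, fun _ _ h ↦ h.elim⟩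

theorem HasShortPaths.mono {c : ℝ≥0} {A B : Set M} (h : HasShortPaths c B) (hAB : A ⊆ B) :
    HasShortPaths c A := by
  obtain ⟨W, G, h₁, h₂, h₃, h₄, h₅, h₆, h₇⟩ := h
  exact ⟨W, G, h₁, h₂, h₃, h₄, h₅, h₆, fun w hw hA ↦ h₇ w hw (hAB hA)⟩

/-- Go from `p` towards `q` by the first family, then on towards `q` by the second. If `q ∈ B`, the
second path arrives; otherwise the first has already arrived and the second is constant. -/
theorem HasShortPaths.union {a b : ℝ≥0} {A B : Set M} (hA : HasShortPaths a A)
    (hB : HasShortPaths b B) : HasShortPaths (a + b) (A ∪ B) := by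
  obtain ⟨V, G, hV, hVd, hG, hGa, hG0, hGd, hG1⟩ := hA
  obtain ⟨V', G', hV', hVd', hG', hGa', hG0', hGd', hG1'⟩ := hB
  have hf : ContinuousOn (fun w : M × M ↦ (G w 1, w.2)) V :=
    ((continuous_eval_const (1 : I)).comp_continuousOn hG).prodMk continuousOn_snd
  have hG'f : ContinuousOn (fun w : M × M ↦ G' (G w 1, w.2))
      (V ∩ (fun w : M × M ↦ (G w 1, w.2)) ⁻¹' V') :=
    hG'.comp (hf.mono inter_subset_left) fun w hw ↦ hw.2
  have hm (w : M × M) (hw : w ∈ V ∩ (fun w : M × M ↦ (G w 1, w.2)) ⁻¹' V') :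
      G w 1 = G' (G w 1, w.2) 0 := (hG0' _ hw.2).symm
  refine ⟨V ∩ (fun w : M × M ↦ (G w 1, w.2)) ⁻¹' V', fun w ↦ curveConcat (G w) (G' (G w 1, w.2)),
    hf.isOpen_inter_preimage hV hV', fun p ↦ ⟨hVd p, ?_⟩,
    (hG.mono inter_subset_left).curveConcat hG'f hm,
    fun w hw ↦ curveConcat_mem_arcSpace (hGa w hw.1) (hGa' _ hw.2) (hm w hw), fun w hw ↦ ?_,
    fun p ↦ ?_, fun w hw hAB ↦ ?_⟩
  · simpa [hGd] using hVd' p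
  · rw [curveConcat_zero (hm w hw), hG0 w hw.1]
  · simp [hGd, hGd', curveConcat_const]
  · rw [curveConcat_one (hm w hw)]
    by_cases hB : w.2 ∈ B
    · exact hG1' _ hw.2 hB
    · rw [hG1 w hw.1 (hAB.resolve_right hB), hGd']
      rfl

variable [IsManifold (𝓡 3) ∞ M] [T2Space M]
  [IsContinuousRiemannianBundle (Euc 3) (fun x : M ↦ TangentSpace (𝓡 3) x)]

open Manifold

/-- Chart segments serve as short paths. Cutting the segment from `p` to `q` at the fraction `ρ q`,
for a bump function `ρ`, makes it constant for `q` outside the support, so the family extends by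
constants. -/
theorem exists_hasShortPaths_nhds (x : M) : ∃ A ∈ 𝓝 x, ∀ c > 0, HasShortPaths c A := by
  have : IsManifold (𝓡 3) 1 M := .of_le (n := ∞) (by norm_num)
  obtain ⟨C, C_pos, r, r_pos, hr, hC⟩ := exists_pathELength_extChartAt_symm_lineMap_le (𝓡 3) x
  simp only [ModelWithCorners.range_eq_univ, inter_univ] at hr hC
  have φ_cont : ContinuousOn (extChartAt (𝓡 3) x) (extChartAt (𝓡 3) x).source :=
    continuousOn_extChartAt x
  have φ_symm_cont : ContinuousOn (extChartAt (𝓡 3) x).symm (extChartAt (𝓡 3) x).target :=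
    continuousOn_extChartAt_symm x
  have φ_symm_smooth : ContMDiffOn 𝓘(ℝ, Euc 3) (𝓡 3) ∞ (extChartAt (𝓡 3) x).symm
    (extChartAt (𝓡 3) x).target := contMDiffOn_extChartAt_symm x
  have φ_open : IsOpen (extChartAt (𝓡 3) x).source := isOpen_extChartAt_source x
  have φ_mem : x ∈ (extChartAt (𝓡 3) x).source := mem_extChartAt_source x
  generalize extChartAt (𝓡 3) x = φ at *
  set B := Metric.ball (φ x) r with hB
  set N : Set M := φ.source ∩ φ ⁻¹' B with hN
  have N_open : IsOpen N := φ_cont.isOpen_inter_preimage φ_open Metric.isOpen_ball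
  have hxN : x ∈ N := ⟨φ_mem, Metric.mem_ball_self r_pos⟩
  have hφc : ContinuousOn φ N := φ_cont.mono inter_subset_left
  have hφ₁ : ContinuousOn (fun w : M × M ↦ φ w.1) (N ×ˢ N) :=
    hφc.comp continuousOn_fst fun w hw ↦ hw.1
  have hφ₂ : ContinuousOn (fun w : M × M ↦ φ w.2) (N ×ˢ N) :=
    hφc.comp continuousOn_snd fun w hw ↦ hw.2
  obtain ⟨ρ, hρ⟩ : ∃ ρ : SmoothBumpFunction (𝓡 3) x, tsupport ρ ⊆ N :=
    ((SmoothBumpFunction.nhds_basis_tsupport x).mem_iff.1 (N_open.mem_nhds hxN)).imp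
      fun _ h ↦ h.2
  -- Where `ρ = 1` the segment reaches `q`. This set is independent of `c`; only the neighbourhood
  -- of the diagonal shrinks with `c`.
  refine ⟨{q | ρ q = 1}, ρ.eventuallyEq_one, fun c hc ↦ ?_⟩
  -- the end point, in the chart, of the segment from `p` towards `q`
  let z : M × M → Euc 3 := fun w ↦ AffineMap.lineMap (φ w.1) (φ w.2) (ρ w.2)
  have hz : ∀ w ∈ N ×ˢ N, z w ∈ B := fun w hw ↦
    (convex_ball _ _).lineMap_mem hw.1.2 hw.2.2 ⟨ρ.nonneg, ρ.le_one⟩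
  have hseg : ∀ w ∈ N ×ˢ N, ∀ s : I, AffineMap.lineMap (φ w.1) (z w) (s : ℝ) ∈ B := fun w hw s ↦
    (convex_ball _ _).lineMap_mem hw.1.2 (hz w hw) s.2
  have hzc : ContinuousOn z (N ×ˢ N) := by
    have h : ContinuousOn (fun w : M × M ↦ ρ w.2) (N ×ˢ N) :=
      (ρ.continuous.comp continuous_snd).continuousOn
    simp only [z, AffineMap.lineMap_apply_module]
    exact ((continuousOn_const.sub h).smul hφ₁).add (h.smul hφ₂)
  have hcont : Continuous fun p : (N ×ˢ N : Set (M × M)) × I ↦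
      φ.symm (AffineMap.lineMap (φ p.1.1.1) (z p.1.1) (p.2 : ℝ)) := by
    refine φ_symm_cont.comp_continuous ?_ fun p ↦ hr (hseg _ p.1.2 p.2)
    have h₁ : Continuous fun p : (N ×ˢ N : Set (M × M)) × I ↦ φ p.1.1.1 :=
      hφ₁.comp_continuous (by fun_prop) fun p ↦ p.1.2
    have h₂ : Continuous fun p : (N ×ˢ N : Set (M × M)) × I ↦ z p.1.1 :=
      hzc.comp_continuous (by fun_prop) fun p ↦ p.1.2
    have h₃ : Continuous fun p : (N ×ˢ N : Set (M × M)) × I ↦ (p.2 : ℝ) := by fun_prop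
    simp only [AffineMap.lineMap_apply_module]
    exact ((continuous_const.sub h₃).smul h₁).add (h₃.smul h₂)
  let S : C((N ×ˢ N : Set (M × M)), C(I, M)) := ContinuousMap.curry ⟨_, hcont⟩
  classical
  let G : M × M → C(I, M) := fun w ↦ if h : w ∈ N ×ˢ N then S ⟨w, h⟩ else .const I w.1
  have hGN (w) (h : w ∈ N ×ˢ N) (s : I) :
      G w s = φ.symm (AffineMap.lineMap (φ w.1) (z w) (s : ℝ)) := by
    simp only [G, dif_pos h]
    rfl
  have hGc (w : M × M) (h : w.2 ∉ tsupport ρ) : G w = .const I w.1 := by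
    by_cases hw : w ∈ N ×ˢ N
    · ext s
      rw [hGN w hw]
      have : z w = φ w.1 := by simp [z, image_eq_zero_of_notMem_tsupport h]
      rw [this, AffineMap.lineMap_same_apply, φ.left_inv hw.1.1]
      rfl
    · simp only [G, dif_neg hw]
  let V : Set (M × M) := {w | w ∈ N ×ˢ N ∧ C * dist (φ w.1) (φ w.2) < c}
  let V' : Set (M × M) := {w | w.2 ∉ tsupport ρ}
  have hVo : IsOpen V := by
    have h : ContinuousOn (fun w : M × M ↦ C * dist (φ w.1) (φ w.2)) (N ×ˢ N) :=
      continuousOn_const.mul (continuous_dist.comp_continuousOn (hφ₁.prodMk hφ₂))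
    exact h.isOpen_inter_preimage (N_open.prod N_open) (isOpen_Iio (a := (c : ℝ)))
  have hVo' : IsOpen V' := (isClosed_tsupport ρ).isOpen_compl.preimage continuous_snd
  refine ⟨V ∪ V', G, hVo.union hVo', fun p ↦ ?_, ?_, ?_, ?_, fun p ↦ ?_, ?_⟩
  · by_cases hp : p ∈ tsupport ρ
    · exact .inl ⟨⟨hρ hp, hρ hp⟩, by simpa using hc⟩
    · exact .inr hp
  · have hGV : ContinuousOn G (N ×ˢ N) := by
      rw [continuousOn_iff_continuous_domRestrict]
      convert S.continuous using 1
      ext w : 1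
      exact dif_pos w.2
    refine ContinuousOn.union_of_isOpen (hGV.mono fun w hw ↦ hw.1) ?_ hVo hVo'
    exact (ContinuousMap.continuous_const'.comp continuous_fst).continuousOn.congr hGc
  · rintro w (hw | hw)
    · have hE : EqOn (IccExtend zero_le_one (G w))
          (φ.symm ∘ AffineMap.lineMap (k := ℝ) (φ w.1) (z w)) (Icc 0 1) := by
        intro s hs
        rw [IccExtend_of_mem _ _ hs, hGN w hw.1]
        rfl
      refine ⟨isPiecewiseContMDiff_iff.2 (.congr (.smooth zero_le_one ?_) hE), ?_⟩
      · refine φ_symm_smooth.comp (t := φ.target) ?_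
          fun s hs ↦ hr (hseg w hw.1 ⟨s, hs⟩)
        refine (ContDiff.contMDiff ?_).contMDiffOn
        exact (ContinuousAffineMap.lineMap (R := ℝ) (φ w.1) (z w)).contDiff
      · rw [curveLength, pathELength_congr hE]
        refine (hC _ hw.1.1.2 _ (hz w hw.1)).trans ?_
        have h₁ : dist (φ w.1) (z w) ≤ dist (φ w.1) (φ w.2) := by
          simp only [z, dist_left_lineMap]
          refine mul_le_of_le_one_left dist_nonneg ?_
          rw [Real.norm_of_nonneg ρ.nonneg]
          exact ρ.le_one
        have h₂ : C * nndist (φ w.1) (z w) ≤ c := by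
          rw [← NNReal.coe_le_coe, NNReal.coe_mul, coe_nndist]
          exact (mul_le_mul_of_nonneg_left h₁ C.2).trans hw.2.le
        rw [edist_nndist]
        exact_mod_cast h₂
    · rw [hGc w hw]
      exact const_mem_arcSpace _ _
  · rintro w (hw | hw)
    · rw [hGN w hw.1]
      simp [φ.left_inv hw.1.1.1]
    · rw [hGc w hw]
      rfl
  · by_cases hp : p ∈ tsupport ρ
    · ext s
      rw [hGN (p, p) ⟨hρ hp, hρ hp⟩]
      simp [z, φ.left_inv (hρ hp).1]
    · exact hGc (p, p) hp
  · intro w hw hw1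
    have h2 : w.2 ∈ tsupport ρ := subset_tsupport _ (by
      rw [Function.mem_support, show ρ w.2 = 1 from hw1]
      exact one_ne_zero)
    have hw' : w ∈ V := hw.resolve_right fun h ↦ h h2
    rw [hGN w hw'.1]
    simp only [z, show ρ w.2 = 1 from hw1, Set.Icc.coe_one, AffineMap.lineMap_apply_one]
    exact φ.left_inv hw'.1.2.1

/-- Compactness reduces this to neighbourhoods of points; each union splits the length budget in
halves. -/
theorem hasShortPaths_univ [CompactSpace M] {c : ℝ≥0} (hc : 0 < c) :
    HasShortPaths c (univ : Set M) := by
  refine isCompact_univ.induction_on (p := fun A : Set M ↦ ∀ c > 0, HasShortPaths c A)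
    (fun c _ ↦ .empty c) (fun A B hAB h c hc ↦ (h c hc).mono hAB) (fun A B hA hB c hc ↦ ?_)
    (fun x _ ↦ ?_) c hc
  · simpa using (hA (c / 2) (half_pos hc)).union (hB (c / 2) (half_pos hc))
  · rw [nhdsWithin_univ]
    exact exists_hasShortPaths_nhds x

end ShortPaths

/-! ### Three-coloured fine covers of compact subsets of the plane -/

section Coloring

/-- The hat function, at the lattice point `v`, of the triangulation of the plane whose edges are
the translates of `(1, 0)`, `(0, 1)` and `(1, 1)`. -/
noncomputable def latticeHat (v : ℤ × ℤ) (y : ℝ × ℝ) : ℝ :=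
  1 - max |y.1 - v.1| (max |y.2 - v.2| |(y.1 - v.1) - (y.2 - v.2)|)

theorem continuous_latticeHat (v : ℤ × ℤ) : Continuous (latticeHat v) := by
  unfold latticeHat
  fun_prop

theorem lt_latticeHat_iff {v : ℤ × ℤ} {y : ℝ × ℝ} : 0 < latticeHat v y ↔
    |y.1 - v.1| < 1 ∧ |y.2 - v.2| < 1 ∧ |(y.1 - v.1) - (y.2 - v.2)| < 1 := by
  rw [latticeHat, sub_pos, max_lt_iff, max_lt_iff]

/-- Lattice points with overlapping stars differ by `0`, `±(1, 0)`, `±(0, 1)` or `±(1, 1)`; the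
nonzero ones have coordinate sum `±1` or `±2`, which is not divisible by 3. -/
theorem eq_of_latticeHat_pos {v w : ℤ × ℤ} {y : ℝ × ℝ} (hv : 0 < latticeHat v y)
    (hw : 0 < latticeHat w y) (h : (v.1 + v.2) % 3 = (w.1 + w.2) % 3) : v = w := by
  simp only [lt_latticeHat_iff, abs_lt] at hv hw
  obtain ⟨⟨a₁, a₂⟩, ⟨a₃, a₄⟩, a₅, a₆⟩ := hv
  obtain ⟨⟨b₁, b₂⟩, ⟨b₃, b₄⟩, b₅, b₆⟩ := hw
  have h₁ : v.1 - w.1 < 2 := by exact_mod_cast (by linarith : (v.1 - w.1 : ℝ) < 2)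
  have h₂ : w.1 - v.1 < 2 := by exact_mod_cast (by linarith : (w.1 - v.1 : ℝ) < 2)
  have h₃ : v.2 - w.2 < 2 := by exact_mod_cast (by linarith : (v.2 - w.2 : ℝ) < 2)
  have h₄ : w.2 - v.2 < 2 := by exact_mod_cast (by linarith : (w.2 - v.2 : ℝ) < 2)
  have h₅ : (v.1 - w.1) - (v.2 - w.2) < 2 := by
    exact_mod_cast (by linarith : ((v.1 - w.1) - (v.2 - w.2) : ℝ) < 2)
  have h₆ : (w.1 - v.1) - (w.2 - v.2) < 2 := by
    exact_mod_cast (by linarith : ((w.1 - v.1) - (w.2 - v.2) : ℝ) < 2)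
  ext <;> omega

/-- The hats at the vertices of a triangle are its barycentric coordinates, so one of the three is
at least `1 / 3`. -/
theorem exists_third_le_latticeHat (y : ℝ × ℝ) : ∃ v, 1 / 3 ≤ latticeHat v y := by
  have key : ∀ v : ℤ × ℤ, |y.1 - v.1| ≤ 2 / 3 → |y.2 - v.2| ≤ 2 / 3 →
      |(y.1 - v.1) - (y.2 - v.2)| ≤ 2 / 3 → 1 / 3 ≤ latticeHat v y := by
    intro v h₁ h₂ h₃
    have := max_le h₁ (max_le h₂ h₃)
    rw [latticeHat]
    linarith
  have h₁ := Int.floor_le y.1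
  have h₂ := Int.lt_floor_add_one y.1
  have h₃ := Int.floor_le y.2
  have h₄ := Int.lt_floor_add_one y.2
  have k₀₀ := key (⌊y.1⌋, ⌊y.2⌋)
  have k₀₁ := key (⌊y.1⌋, ⌊y.2⌋ + 1)
  have k₁₀ := key (⌊y.1⌋ + 1, ⌊y.2⌋)
  have k₁₁ := key (⌊y.1⌋ + 1, ⌊y.2⌋ + 1)
  push_cast [abs_le] at k₀₀ k₀₁ k₁₀ k₁₁
  by_cases c₁ : max (y.1 - ⌊y.1⌋) (y.2 - ⌊y.2⌋) ≤ 2 / 3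
  · rw [max_le_iff] at c₁
    exact ⟨_, k₀₀ ⟨by linarith, by linarith⟩ ⟨by linarith, by linarith⟩
      ⟨by linarith, by linarith⟩⟩
  by_cases c₂ : 1 / 3 ≤ min (y.1 - ⌊y.1⌋) (y.2 - ⌊y.2⌋)
  · rw [le_min_iff] at c₂
    exact ⟨_, k₁₁ ⟨by linarith, by linarith⟩ ⟨by linarith, by linarith⟩
      ⟨by linarith, by linarith⟩⟩
  rw [max_le_iff, not_and_or, not_le, not_le] at c₁
  rw [le_min_iff, not_and_or, not_le, not_le] at c₂
  rcases c₁ with c₁ | c₁ <;> rcases c₂ with c₂ | c₂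
  · linarith
  · exact ⟨_, k₁₀ ⟨by linarith, by linarith⟩ ⟨by linarith, by linarith⟩
      ⟨by linarith, by linarith⟩⟩
  · exact ⟨_, k₀₁ ⟨by linarith, by linarith⟩ ⟨by linarith, by linarith⟩
      ⟨by linarith, by linarith⟩⟩
  · linarith

variable {K : Type*} [TopologicalSpace K] [CompactSpace K]

/-- The distance of the images attains its minimum on the compact complement of `N`, and injectivity
makes this minimum positive. -/
theorem exists_pos_dist_lt_imp_mem {X : Type*} [MetricSpace X] {f : K → X} (hf : Continuous f)
    (hinj : Function.Injective f) {N : Set (K × K)} (hN : IsOpen N) (hd : ∀ x, (x, x) ∈ N) :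
    ∃ ε > 0, ∀ x y, dist (f x) (f y) < ε → (x, y) ∈ N := by
  rcases (Nᶜ).eq_empty_or_nonempty with h | h
  · exact ⟨1, one_pos, fun x y _ ↦ by simp [compl_empty_iff.1 h]⟩
  have hc : Continuous fun p : K × K ↦ dist (f p.1) (f p.2) := by fun_prop
  obtain ⟨p, hp, hmin⟩ := hN.isClosed_compl.isCompact.exists_isMinOn h hc.continuousOn
  refine ⟨dist (f p.1) (f p.2), dist_pos.2 fun h ↦ hp ?_, fun x y hxy ↦ ?_⟩
  · have : p = (p.1, p.1) := Prod.ext rfl (hinj h).symm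
    rw [this]
    exact hd _
  · by_contra hxy'
    exact (hmin hxy').not_gt hxy

/-- A compact subset of the plane has arbitrarily fine open covers by three families of pairwise
disjoint sets. Here `U c` is the union of the `c`-th family, `ξ c` selects a point in each of its
members, and the functions `ψ c`, supported in `U c`, are not simultaneously small. -/
theorem exists_three_coloring {f : K → ℝ × ℝ} (hf : Continuous f) (hinj : Function.Injective f)
    {N : Set (K × K)} (hN : IsOpen N) (hd : ∀ x, (x, x) ∈ N) :
    ∃ (ψ : Fin 3 → C(K, ℝ)) (U : Fin 3 → Set K) (ξ : Fin 3 → K → K),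
      (∀ c x, 0 ≤ ψ c x) ∧ (∀ x, ∃ c, 1 ≤ ψ c x) ∧ (∀ c, IsOpen (U c)) ∧
      (∀ c, ∀ x ∉ U c, ∀ᶠ y in 𝓝 x, ψ c y = 0) ∧
      (∀ c, ∀ x ∈ U c, ∀ᶠ y in 𝓝 x, ξ c y = ξ c x) ∧ ∀ c, ∀ x ∈ U c, (ξ c x, x) ∈ N := by
  obtain ⟨ε, hε, hεN⟩ := exists_pos_dist_lt_imp_mem hf hinj hN hd
  -- After scaling by `m`, points of one star differ by less than 2 in each coordinate, hence by
  -- less than `2 / m < ε` before.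
  obtain ⟨m, hm⟩ := exists_nat_gt (2 / ε)
  have hm0 : (0 : ℝ) < m := (div_pos two_pos hε).trans hm
  let g : K → ℝ × ℝ := fun x ↦ (m * (f x).1, m * (f x).2)
  have hg : Continuous g := by fun_prop
  have hgN (v : ℤ × ℤ) (x y : K) (hx : 0 < latticeHat v (g x)) (hy : 0 < latticeHat v (g y)) :
      (x, y) ∈ N := by
    refine hεN x y ?_
    simp only [lt_latticeHat_iff, abs_lt, g] at hx hy
    rw [div_lt_iff₀ hε] at hm
    rw [Prod.dist_eq, max_lt_iff, Real.dist_eq, Real.dist_eq, abs_lt, abs_lt]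
    refine ⟨⟨?_, ?_⟩, ?_, ?_⟩ <;> refine lt_of_mul_lt_mul_left ?_ hm0.le <;> linarith
  obtain ⟨R, hR⟩ := (isCompact_range hg).isBounded.exists_norm_le
  obtain ⟨k, hk⟩ := exists_nat_ge R
  let B : Finset (ℤ × ℤ) := Finset.Icc (-(k + 1 : ℤ)) (k + 1) ×ˢ Finset.Icc (-(k + 1 : ℤ)) (k + 1)
  have hB (v : ℤ × ℤ) (x : K) (h : 0 < latticeHat v (g x)) : v ∈ B := by
    have h' := (hR _ (mem_range_self x)).trans hk
    rw [Prod.norm_def, max_le_iff, Real.norm_eq_abs, Real.norm_eq_abs, abs_le, abs_le] at h'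
    simp only [lt_latticeHat_iff, abs_lt] at h
    simp only [B, Finset.mem_product, Finset.mem_Icc]
    have h₁ : (-(k + 1) : ℝ) ≤ v.1 := by linarith
    have h₂ : (v.1 : ℝ) ≤ k + 1 := by linarith
    have h₃ : (-(k + 1) : ℝ) ≤ v.2 := by linarith
    have h₄ : (v.2 : ℝ) ≤ k + 1 := by linarith
    exact ⟨⟨by exact_mod_cast h₁, by exact_mod_cast h₂⟩, by exact_mod_cast h₃, by exact_mod_cast h₄⟩
  let P : Fin 3 → K → ℤ × ℤ → Prop := fun c x v ↦
    (v.1 + v.2) % 3 = (c : ℕ) ∧ 0 < latticeHat v (g x)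
  have hP {c x v w} (hv : P c x v) (hw : P c x w) : v = w :=
    eq_of_latticeHat_pos hv.2 hw.2 (hv.1.trans hw.1.symm)
  have hev {c x v} (hv : P c x v) : ∀ᶠ y in 𝓝 x, P c y v := by
    have := (((continuous_latticeHat v).comp hg).tendsto x).eventually_const_lt hv.2
    filter_upwards [this] with y hy
    exact ⟨hv.1, hy⟩
  classical
  -- a point in the star of each lattice point
  have hw : ∀ v : ℤ × ℤ, ∃ F : K → K, (∀ x y, F x = F y ∨ ∀ z, ¬ 0 < latticeHat v (g z)) ∧
      ∀ x, 0 < latticeHat v (g x) → 0 < latticeHat v (g (F x)) := by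
    intro v
    by_cases h : ∃ z, 0 < latticeHat v (g z)
    · obtain ⟨z, hz⟩ := h
      exact ⟨fun _ ↦ z, fun _ _ ↦ .inl rfl, fun _ _ ↦ hz⟩
    · exact ⟨id, fun _ _ ↦ .inr (not_exists.1 h), fun _ h ↦ h⟩
  choose w hw₁ hw₂ using hw
  let ξ : Fin 3 → K → K := fun c x ↦ if h : ∃ v, P c x v then w h.choose x else x
  have hξ {c x v} (hv : P c x v) : ξ c x = w v x := by
    have h : ∃ v, P c x v := ⟨v, hv⟩
    simp only [ξ, dif_pos h, hP h.choose_spec hv]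
  let D : Fin 3 → Finset (ℤ × ℤ) := fun c ↦ B.filter fun v ↦ (v.1 + v.2) % 3 = (c : ℕ)
  -- Truncating at `1 / 6` makes the sum vanish near every point outside `U c`, not just at it; the
  -- factor 6 gives the value 1 at height `1 / 3`.
  have hψ (c : Fin 3) : Continuous fun x ↦ ∑ v ∈ D c, 6 * max 0 (latticeHat v (g x) - 1 / 6) :=
    continuous_finsetSum _ fun v _ ↦ continuous_const.mul
      (continuous_const.max (((continuous_latticeHat v).comp hg).sub continuous_const))
  refine ⟨fun c ↦ ⟨_, hψ c⟩, fun c ↦ {x | ∃ v, P c x v}, ξ,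
    fun c x ↦ Finset.sum_nonneg fun v _ ↦ by positivity, fun x ↦ ?_, fun c ↦ ?_, fun c x hx ↦ ?_,
    fun c x hx ↦ ?_, fun c x hx ↦ ?_⟩
  · obtain ⟨v, hv⟩ := exists_third_le_latticeHat (g x)
    have hmod : ((v.1 + v.2) % 3) = (((v.1 + v.2) % 3).toNat : ℤ) := by omega
    refine ⟨⟨((v.1 + v.2) % 3).toNat, by omega⟩, ?_⟩
    have hvB : v ∈ D ⟨((v.1 + v.2) % 3).toNat, by omega⟩ :=
      Finset.mem_filter.2 ⟨hB v x (by linarith), hmod⟩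
    refine le_trans ?_ (Finset.single_le_sum (f := fun v ↦ 6 * max 0 (latticeHat v (g x) - 1 / 6))
      (fun v _ ↦ by positivity) hvB)
    have := le_max_right 0 (latticeHat v (g x) - 1 / 6)
    linarith
  · rw [isOpen_iff_mem_nhds]
    rintro x ⟨v, hv⟩
    filter_upwards [hev hv] with y hy
    exact ⟨v, hy⟩
  · have : ∀ᶠ y in 𝓝 x, ∀ v ∈ D c, latticeHat v (g y) < 1 / 6 := by
      rw [Filter.eventually_all_finset]
      intro v hv
      refine (((continuous_latticeHat v).comp hg).tendsto x).eventually_lt_const ?_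
      have : ¬ 0 < latticeHat v (g x) := fun h ↦ hx ⟨v, (Finset.mem_filter.1 hv).2, h⟩
      exact (not_lt.1 this).trans_lt (by norm_num)
    filter_upwards [this] with y hy
    refine Finset.sum_eq_zero fun v hv ↦ ?_
    rw [max_eq_left (by linarith [hy v hv]), mul_zero]
  · obtain ⟨v, hv⟩ := hx
    filter_upwards [hev hv] with y hy
    rw [hξ hv, hξ hy]
    exact (hw₁ v y x).resolve_right fun h ↦ h x hv.2
  · obtain ⟨v, hv⟩ := hx
    rw [hξ hv]
    exact hgN v _ _ (hw₂ v x hv.2) hv.2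

end Coloring

/-! ### Arcs connecting the points of a single curve -/

section ConnectingArcs

/-- Here `W` replaces an entourage: the violating `(x, t, t', u)` form a compact set off `t = t'`,
on which `dist t t'` has a positive minimum. -/
theorem exists_pos_forall_dist_lt_mem {K M : Type*} [TopologicalSpace K] [TopologicalSpace M]
    {C : Set K} (hC : IsCompact C) {Φ : K × I → C(I, M)} (hΦ : ContinuousOn Φ (C ×ˢ univ))
    {W : Set (M × M)} (hW : IsOpen W) (hd : ∀ p, (p, p) ∈ W) :
    ∃ ε > 0, ∀ x ∈ C, ∀ t t' u : I, dist t t' < ε → (Φ (x, t) u, Φ (x, t') u) ∈ W := by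
  have := isCompact_iff_compactSpace.1 hC
  have hΦ' : Continuous fun q : C × I ↦ Φ (q.1, q.2) :=
    hΦ.comp_continuous (by fun_prop) fun q ↦ ⟨q.1.2, mem_univ _⟩
  have hΨ : Continuous fun q : C × I × I × I ↦
      (Φ (q.1, q.2.1) q.2.2.2, Φ (q.1, q.2.2.1) q.2.2.2) := by
    have h₁ : Continuous fun q : C × I × I × I ↦ Φ (q.1, q.2.1) :=
      hΦ'.comp (f := fun q : C × I × I × I ↦ (q.1, q.2.1)) (by fun_prop)
    have h₂ : Continuous fun q : C × I × I × I ↦ Φ (q.1, q.2.2.1) :=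
      hΦ'.comp (f := fun q : C × I × I × I ↦ (q.1, q.2.2.1)) (by fun_prop)
    have h₃ : Continuous fun q : C × I × I × I ↦ q.2.2.2 := by fun_prop
    exact (continuous_eval.comp (h₁.prodMk h₃)).prodMk (continuous_eval.comp (h₂.prodMk h₃))
  set Z := ((fun q : C × I × I × I ↦
      (Φ (q.1, q.2.1) q.2.2.2, Φ (q.1, q.2.2.1) q.2.2.2)) ⁻¹' W)ᶜ with hZ
  have hZc : IsCompact Z := (hW.preimage hΨ).isClosed_compl.isCompact
  rcases Z.eq_empty_or_nonempty with h | h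
  · refine ⟨1, one_pos, fun x hx t t' u _ ↦ ?_⟩
    have : (⟨x, hx⟩, t, t', u) ∉ Z := by simp [h]
    simpa [hZ] using this
  · have hc : Continuous fun q : C × I × I × I ↦ dist q.2.1 q.2.2.1 := by fun_prop
    obtain ⟨q, hq, hmin⟩ := hZc.exists_isMinOn h hc.continuousOn
    refine ⟨dist q.2.1 q.2.2.1, dist_pos.2 fun h ↦ hq ?_, fun x hx t t' u htt ↦ ?_⟩
    · simp only [mem_preimage, h, hd]
    · by_contra hW'
      exact (hmin (show (⟨x, hx⟩, t, t', u) ∈ Z from hW')).not_gt htt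

variable {M : Type*} [TopologicalSpace M] [ChartedSpace (Euc 3) M]
  [RiemannianBundle (fun x : M ↦ TangentSpace (𝓡 3) x)] {K : Type*} [TopologicalSpace K]

/-- If the arcs `Φ (x, t)` end at a point independent of `t`, then their initial points are
connected by arcs that depend continuously on `x` and on the pair of parameters, run along the
given arcs, and are constant for equal parameters. -/
theorem exists_connecting_arcs {c : ℝ≥0} (hM : HasShortPaths c (univ : Set M)) {C : Set K}
    (hC : IsCompact C) {Φ : K × I → C(I, M)} (hΦ : ContinuousOn Φ (C ×ˢ univ))
    (hend : ∀ x ∈ C, ∀ t t', Φ (x, t) 1 = Φ (x, t') 1) {a b : ℝ≥0}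
    (ha : ∀ x ∈ C, ∀ t, Φ (x, t) ∈ arcSpace M a) (hb : ∀ x ∈ C, Φ (x, 0) ∈ arcSpace M b) :
    ∃ Q : K × I × I → C(I, M), ContinuousOn Q (C ×ˢ univ) ∧
      (∀ x ∈ C, ∀ r r', Q (x, r, r') ∈ arcSpace M (a + (c + a))) ∧
      (∀ x ∈ C, ∀ r, Q (x, 0, r) ∈ arcSpace M (b + (c + a))) ∧
      (∀ x ∈ C, ∀ r r', Q (x, r, r') 0 = Φ (x, r) 0) ∧
      (∀ x ∈ C, ∀ r r', Q (x, r, r') 1 = Φ (x, r') 0) ∧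
      ∀ x ∈ C, ∀ r, Q (x, r, r) = ContinuousMap.const I (Φ (x, r) 0) := by
  obtain ⟨W, G, hW, hWd, hGc, hGa, hG0, hGd, hG1⟩ := hM
  obtain ⟨ε, hε, hεW⟩ := exists_pos_forall_dist_lt_mem hC hΦ hW hWd
  -- The turning parameter. It is 0 for `r = r'`, so the arc is constant there; once `dist r r' ≥ ε`
  -- it is 1, where the two arcs meet. In between, `ε` keeps the gap inside `W`.
  let l : K × I × I → I := fun q ↦ projIcc 0 1 zero_le_one (dist q.2.1 q.2.2 / ε)
  have hl : Continuous l := by fun_prop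
  let J : K × I × I → M × M := fun q ↦ (Φ (q.1, q.2.1) (l q), Φ (q.1, q.2.2) (l q))
  have hJW : ∀ q ∈ C ×ˢ (univ : Set (I × I)), J q ∈ W := by
    rintro ⟨x, r, r'⟩ hq
    rcases lt_or_ge (dist r r') ε with h | h
    · exact hεW x hq.1 r r' _ h
    · have h1 : l (x, r, r') = 1 := projIcc_of_right_le _ ((one_le_div hε).2 h)
      simp only [J, h1, hend x hq.1 r r', hWd]
  have h₁ : ContinuousOn (fun q : K × I × I ↦ Φ (q.1, q.2.1)) (C ×ˢ univ) :=
    hΦ.comp (f := fun q : K × I × I ↦ (q.1, q.2.1)) (by fun_prop) fun q hq ↦ ⟨hq.1, mem_univ _⟩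
  have h₂ : ContinuousOn (fun q : K × I × I ↦ Φ (q.1, q.2.2)) (C ×ˢ univ) :=
    hΦ.comp (f := fun q : K × I × I ↦ (q.1, q.2.2)) (by fun_prop) fun q hq ↦ ⟨hq.1, mem_univ _⟩
  have hJ : ContinuousOn J (C ×ˢ univ) :=
    (continuous_eval.comp_continuousOn (h₁.prodMk hl.continuousOn)).prodMk
      (continuous_eval.comp_continuousOn (h₂.prodMk hl.continuousOn))
  have m₂ (q) (hq : q ∈ C ×ˢ (univ : Set (I × I))) :
      G (J q) 1 = curveRev (curveInit (Φ (q.1, q.2.2)) (l q)) 0 := by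
    rw [hG1 _ (hJW q hq) (mem_univ _)]
    simp [J]
  have m₁ (q) (hq : q ∈ C ×ˢ (univ : Set (I × I))) : curveInit (Φ (q.1, q.2.1)) (l q) 1 =
      curveConcat (G (J q)) (curveRev (curveInit (Φ (q.1, q.2.2)) (l q))) 0 := by
    rw [curveConcat_zero (m₂ q hq), hG0 _ (hJW q hq)]
    simp [J]
  refine ⟨fun q ↦ curveConcat (curveInit (Φ (q.1, q.2.1)) (l q))
    (curveConcat (G (J q)) (curveRev (curveInit (Φ (q.1, q.2.2)) (l q)))), ?_,
    fun x hx r r' ↦ ?_, fun x hx r ↦ ?_, fun x hx r r' ↦ ?_, fun x hx r r' ↦ ?_, fun x hx r ↦ ?_⟩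
  · exact (continuous_curveInit.comp_continuousOn (h₁.prodMk hl.continuousOn)).curveConcat
      ((hGc.comp hJ hJW).curveConcat (continuous_curveRev.comp_continuousOn
        (continuous_curveInit.comp_continuousOn (h₂.prodMk hl.continuousOn))) m₂) m₁
  · have hq : (x, r, r') ∈ C ×ˢ (univ : Set (I × I)) := ⟨hx, mem_univ _⟩
    exact curveConcat_mem_arcSpace (curveInit_mem_arcSpace (ha x hx r) _)
      (curveConcat_mem_arcSpace (hGa _ (hJW _ hq))
        (curveRev_mem_arcSpace (curveInit_mem_arcSpace (ha x hx r') _)) (m₂ _ hq)) (m₁ _ hq)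
  · have hq : (x, 0, r) ∈ C ×ˢ (univ : Set (I × I)) := ⟨hx, mem_univ _⟩
    exact curveConcat_mem_arcSpace (curveInit_mem_arcSpace (hb x hx) _)
      (curveConcat_mem_arcSpace (hGa _ (hJW _ hq))
        (curveRev_mem_arcSpace (curveInit_mem_arcSpace (ha x hx r) _)) (m₂ _ hq)) (m₁ _ hq)
  · have hq : (x, r, r') ∈ C ×ˢ (univ : Set (I × I)) := ⟨hx, mem_univ _⟩
    simp [curveConcat_zero (m₁ _ hq)]
  · have hq : (x, r, r') ∈ C ×ˢ (univ : Set (I × I)) := ⟨hx, mem_univ _⟩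
    simp [curveConcat_one (m₁ _ hq), curveConcat_one (m₂ _ hq)]
  · have hl0 : l (x, r, r) = 0 := by simp [l]
    simp only [J, hl0, hGd, curveInit_zero, curveRev_const, curveConcat_const]

/-- The connecting arcs between the points of a curve `F x` that are obtained from a continuous
family `α` of arcs from a point to the points of a nearby curve `F ξ`. -/
theorem exists_connecting_arcs_of_near {c : ℝ≥0} {W : Set (M × M)} {G : M × M → C(I, M)}
    (hGc : ContinuousOn G W) (hGa : ∀ w ∈ W, G w ∈ arcSpace M c) (hG0 : ∀ w ∈ W, G w 0 = w.1)
    (hG1 : ∀ w ∈ W, G w 1 = w.2) (hM : HasShortPaths c (univ : Set M)) (F : C(K, C(I, M)))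
    {ξ : K} {L : ℝ≥0} {α : C(I, C(I, M))} (hα : ∀ t, α t ∈ arcSpace M L)
    (hα0 : ∀ t, α t 0 = F ξ 0) (hα1 : ∀ t, α t 1 = F ξ t) (hαc : IsConstantCurve (α 0))
    {C : Set K} (hC : IsCompact C) (hCW : ∀ x ∈ C, ∀ t, (F x t, F ξ t) ∈ W) :
    ∃ Q : K × I × I → C(I, M), ContinuousOn Q (C ×ˢ univ) ∧
      (∀ x ∈ C, ∀ r r', Q (x, r, r') ∈ arcSpace M (2 * L + 3 * c)) ∧
      (∀ x ∈ C, ∀ r, Q (x, 0, r) ∈ arcSpace M (L + 3 * c)) ∧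
      (∀ x ∈ C, ∀ r r', Q (x, r, r') 0 = F x r) ∧
      (∀ x ∈ C, ∀ r r', Q (x, r, r') 1 = F x r') ∧
      ∀ x ∈ C, ∀ r, Q (x, r, r) = ContinuousMap.const I (F x r) := by
  let Φ : K × I → C(I, M) := fun q ↦ curveConcat (G (F q.1 q.2, F ξ q.2)) (curveRev (α q.2))
  have hm (x : K) (hx : x ∈ C) (t : I) : G (F x t, F ξ t) 1 = curveRev (α t) 0 := by
    rw [hG1 _ (hCW x hx t)]
    simp [hα1]
  have hΦ0 (x : K) (hx : x ∈ C) (t : I) : Φ (x, t) 0 = F x t := by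
    simp only [Φ, curveConcat_zero (hm x hx t), hG0 _ (hCW x hx t)]
  have hΦ1 (x : K) (hx : x ∈ C) (t : I) : Φ (x, t) 1 = F ξ 0 := by
    simp only [Φ, curveConcat_one (hm x hx t)]
    simp [hα0]
  have hΦc : ContinuousOn Φ (C ×ˢ univ) := by
    refine ContinuousOn.curveConcat (hGc.comp (f := fun q : K × I ↦ (F q.1 q.2, F ξ q.2)) ?_ ?_) ?_
      fun q hq ↦ hm q.1 hq.1 q.2
    · exact Continuous.continuousOn (by fun_prop)
    · exact fun q hq ↦ hCW q.1 hq.1 q.2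
    · exact (continuous_curveRev.comp (α.continuous.comp continuous_snd)).continuousOn
  -- This saves one `L` for arcs that start at parameter 0.
  have h0 : α 0 ∈ arcSpace M 0 := by
    obtain ⟨p, hp⟩ := hαc
    rw [hp]
    exact const_mem_arcSpace p 0
  obtain ⟨Q, hQ, hQa, hQb, hQ0, hQ1, hQd⟩ := exists_connecting_arcs hM hC hΦc
    (fun x hx t t' ↦ (hΦ1 x hx t).trans (hΦ1 x hx t').symm)
    (fun x hx t ↦ curveConcat_mem_arcSpace (hGa _ (hCW x hx t)) (curveRev_mem_arcSpace (hα t))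
      (hm x hx t))
    (fun x hx ↦ curveConcat_mem_arcSpace (hGa _ (hCW x hx 0)) (curveRev_mem_arcSpace h0)
      (hm x hx 0))
  refine ⟨Q, hQ, fun x hx r r' ↦ ?_, fun x hx r ↦ ?_,
    fun x hx r r' ↦ (hQ0 x hx r r').trans (hΦ0 x hx r),
    fun x hx r r' ↦ (hQ1 x hx r r').trans (hΦ0 x hx r'),
    fun x hx r ↦ (hQd x hx r).trans (by rw [hΦ0 x hx r])⟩
  · exact arcSpace_mono (le_of_eq (by ring)) (hQa x hx r r')
  · exact arcSpace_mono (le_of_eq (by ring)) (hQb x hx r)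

end ConnectingArcs

/-! ### Gluing connecting arcs along a locally constant choice -/

section Gluing

variable {M : Type*} [TopologicalSpace M] {K : Type*} [TopologicalSpace K]

open Classical in
/-- Arcs between points of the curves `F x`, chosen according to the locally constant map `ξ` on
`U`, and constant outside of `U`. -/
noncomputable def gluedArcs (F : K → C(I, M)) (U : Set K) (ξ : K → K)
    (Q : K → K × I × I → C(I, M)) (q : K × I × I) : C(I, M) :=
  if q.1 ∈ U then Q (ξ q.1) q else ContinuousMap.const I (F q.1 q.2.1)

/-- Inside `U` the choice `ξ` is locally constant, so a single `Q (ξ x)` is used. Near a point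
outside `U` the two parameters agree, and both branches of the definition give the same constant
arc. -/
theorem continuous_gluedArcs (F : C(K, C(I, M))) {U : Set K} (hU : IsOpen U) {ξ : K → K}
    (hξ : ∀ x ∈ U, ∀ᶠ y in 𝓝 x, ξ y = ξ x) {Q : K → K × I × I → C(I, M)} {N : Set (K × K)}
    (hN : IsOpen N) (hξN : ∀ x ∈ U, (ξ x, x) ∈ N)
    (hQ : ∀ ξ, ContinuousOn (Q ξ) ({x | (ξ, x) ∈ N} ×ˢ univ))
    (hQd : ∀ ξ x, (ξ, x) ∈ N → ∀ r, Q ξ (x, r, r) = ContinuousMap.const I (F x r))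
    {r r' : K × I → I} (hr : Continuous r) (hr' : Continuous r')
    (hrr' : ∀ x ∉ U, ∀ᶠ y in 𝓝 x, ∀ t, r (y, t) = r' (y, t)) :
    Continuous fun q : K × I ↦ gluedArcs F U ξ Q (q.1, r q, r' q) := by
  rw [continuous_iff_continuousAt]
  rintro ⟨x, t⟩
  by_cases hx : x ∈ U
  · have hmem : {y | (ξ x, y) ∈ N} ×ˢ (univ : Set (I × I)) ∈ 𝓝 (x, r (x, t), r' (x, t)) :=
      prod_mem_nhds ((hN.preimage (Continuous.prodMk_right (ξ x))).mem_nhds (hξN x hx))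
        Filter.univ_mem
    have h : ContinuousAt (fun q : K × I ↦ Q (ξ x) (q.1, r q, r' q)) (x, t) :=
      ContinuousAt.comp (f := fun q : K × I ↦ (q.1, r q, r' q)) ((hQ (ξ x)).continuousAt hmem)
        (by fun_prop)
    refine h.congr ?_
    filter_upwards [continuousAt_fst.eventually ((hU.mem_nhds hx)),
      continuousAt_fst.eventually (hξ x hx)] with q hq hq'
    have hqU : q.1 ∈ U := hq
    simp only [gluedArcs, if_pos hqU, hq']
  · have h : Continuous fun q : K × I ↦ ContinuousMap.const I (F q.1 (r q)) :=
      ContinuousMap.continuous_const'.comp (by fun_prop)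
    refine h.continuousAt.congr ?_
    filter_upwards [continuousAt_fst.eventually (hrr' x hx)] with q hq
    unfold gluedArcs
    split_ifs with hqU
    · rw [← show r q = r' q from hq q.2, hQd _ _ (hξN _ hqU)]
    · rfl

end Gluing

/-! ### The homotopy from `F` to the end of the contraction -/

section Contraction

variable {M : Type*} [TopologicalSpace M] [ChartedSpace (Euc 3) M]
  {K : Type*} [TopologicalSpace K]

/-- If the arcs `H (x, t)` join `F x 0` to `F x t` and are constant for `t = 0`, then they provide
a homotopy from `F` to `H (·, 1)`: at time `s`, replace `F x` on `[0, s]` by `H (x, s)`. -/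
theorem homotopicWith_of_arcs {F : C(K, C(I, M))} (hF : ∀ x, F x ∈ loopSpace M) {B : Set K}
    (hFB : ∀ x ∈ B, IsConstantCurve (F x)) {H : C(K × I, C(I, M))}
    (hH : ∀ x t, IsPiecewiseContMDiff 1 (H (x, t))) (hHB : ∀ x ∈ B, ∀ t, IsConstantCurve (H (x, t)))
    (h0 : ∀ x, H (x, 0) = ContinuousMap.const I (F x 0)) (hH0 : ∀ x t, H (x, t) 0 = F x 0)
    (hH1 : ∀ x t, H (x, t) 1 = F x t) :
    ContinuousMap.HomotopicWith F
      (H.comp ((ContinuousMap.id K).prodMk (ContinuousMap.const K 1)))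
      (fun G ↦ (∀ x, G x ∈ loopSpace M) ∧ ∀ x ∈ B, G x = F x) := by
  let f : (I × K) × I → M := fun q ↦ H (q.1.2, q.1.1) (projIcc 0 1 zero_le_one (q.2 / q.1.1 : ℝ))
  -- At `s = 0` the quotient `u / s` has no limit, but `H (x, 0)` is constant, so all of `H (y, s)`
  -- stays near `F x 0` for `(y, s)` near `(x, 0)`.
  have hf : Continuous f := by
    rw [continuous_iff_continuousAt]
    rintro ⟨⟨s, x⟩, u⟩
    rcases eq_or_ne s 0 with rfl | hs
    · rw [ContinuousAt, Filter.tendsto_def]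
      intro V hV
      have hV' : V ∈ 𝓝 (F x 0) := by simpa [f, h0] using hV
      obtain ⟨V', hVV', hV'o, hxV'⟩ := mem_nhds_iff.1 hV'
      have hmaps : MapsTo (H (x, 0)) univ V' := fun v _ ↦ by simpa [h0] using hxV'
      have := H.continuous.continuousAt (x := (x, 0)) |>.eventually
        (ContinuousMap.eventually_mapsTo isCompact_univ hV'o hmaps)
      have hc : ContinuousAt (fun q : (I × K) × I ↦ (q.1.2, q.1.1)) ((0, x), u) := by fun_prop
      filter_upwards [hc.eventually this] with q hq
      exact hVV' (hq (mem_univ _))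
    · have hs' : (s : ℝ) ≠ 0 := fun h ↦ hs (Subtype.ext h)
      have h₁ : ContinuousAt (fun q : (I × K) × I ↦ (q.2 / q.1.1 : ℝ)) ((s, x), u) :=
        ContinuousAt.div (by fun_prop) (by fun_prop) hs'
      have h₂ : ContinuousAt (fun q : (I × K) × I ↦
          (H (q.1.2, q.1.1), projIcc 0 1 zero_le_one (q.2 / q.1.1 : ℝ))) ((s, x), u) :=
        ContinuousAt.prodMk (Continuous.continuousAt (by fun_prop))
          (continuous_projIcc.continuousAt.comp h₁)
      exact continuous_eval.continuousAt.comp h₂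
  let g : (I × K) × I → M := fun q ↦ if q.2 ≤ q.1.1 then f q else F q.1.2 q.2
  have hfg (s : I) (x : K) : f ((s, x), s) = F x s := by
    rcases eq_or_ne s 0 with rfl | hs
    · simp [f, h0]
    · have hs' : (s : ℝ) ≠ 0 := fun h ↦ hs (Subtype.ext h)
      simp [f, div_self hs', hH1]
  have hg : Continuous g := by
    refine Continuous.if_le hf (by fun_prop) (by fun_prop) (by fun_prop) ?_
    rintro ⟨⟨s, x⟩, u⟩ (rfl : u = s)
    exact hfg u x
  have hg_right (s : I) (x : K) (u : I) (hu : s ≤ u) : g ((s, x), u) = F x u := by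
    rcases hu.eq_or_lt with rfl | hu
    · simp only [g, le_refl, if_true, hfg]
    · simp only [g, hu.not_ge, if_false]
  have hg_left (s : I) (x : K) (u : I) (hu : u ≤ s) : g ((s, x), u) = f ((s, x), u) := if_pos hu
  let h : C(I × K, C(I, M)) := ContinuousMap.curry ⟨g, hg⟩
  have hh (s x u) : h (s, x) u = g ((s, x), u) := rfl
  have hh0 (x) : h (0, x) = F x := ContinuousMap.ext fun u ↦ hg_right 0 x u u.2.1
  refine ⟨⟨⟨h, hh0, fun x ↦ ?_⟩, fun s ↦ ⟨fun x ↦ ⟨?_, ?_⟩, fun x hx ↦ ?_⟩⟩⟩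
  · ext u
    rw [ContinuousMap.toFun_eq_coe, hh, hg_left 1 x u u.2.2]
    simp [f]
  · change h (s, x) 0 = h (s, x) 1
    rw [hh, hh, hg_left s x 0 s.2.1, hg_right s x 1 s.2.2, ← (hF x).1]
    simp [f, hH0]
  · change IsPiecewiseContMDiff 1 (h (s, x))
    rcases eq_or_ne s 0 with rfl | hs
    · rw [hh0]
      exact (hF x).2
    have hs' : (0 : ℝ) < s := unitInterval.pos_iff_ne_zero.2 hs
    rw [isPiecewiseContMDiff_iff]
    refine .trans (b := s) (.congr (.comp_mul_add (inv_pos.2 hs') (k := 0)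
      (γ := IccExtend zero_le_one (H (x, s))) ?_) fun u hu ↦ ?_)
      (.congr (.mono (isPiecewiseContMDiff_iff.1 (hF x).2) s.2.1 s.2.2 le_rfl) fun u hu ↦ ?_)
    · simp only [mul_zero, add_zero, inv_mul_cancel₀ hs'.ne']
      exact isPiecewiseContMDiff_iff.1 (hH x s)
    · have hu' : u ∈ I := ⟨hu.1, hu.2.trans s.2.2⟩
      rw [IccExtend_of_mem _ _ hu', hh, hg_left s x ⟨u, hu'⟩ hu.2]
      simp [f, IccExtend, div_eq_inv_mul]
    · have hu' : u ∈ I := ⟨s.2.1.trans hu.1, hu.2⟩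
      rw [IccExtend_of_mem _ _ hu', IccExtend_of_mem _ _ hu', hh, hg_right s x ⟨u, hu'⟩ hu.1]
  · change h (s, x) = F x
    obtain ⟨p, hp⟩ := hFB x hx
    obtain ⟨p', hp'⟩ := hHB x hx s
    have hpp' : p' = p := by
      have := hH0 x s
      rwa [hp', hp] at this
    ext u
    rw [hh]
    simp only [g, f, hp, hp', hpp', ContinuousMap.const_apply, ite_self]

end Contraction

/-! ### The parameter disc: embedding, stopping times, neighbourhoods of the diagonal -/

section Disc

variable {K : Type*} [TopologicalSpace K]

theorem isClosed_discBoundary (e : K ≃ₜ Metric.closedBall (0 : Euc 2) 1) :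
    IsClosed (discBoundary e) :=
  isClosed_eq (continuous_norm.comp (continuous_subtype_val.comp e.continuous)) continuous_const

theorem exists_continuous_injective_of_disc (e : K ≃ₜ Metric.closedBall (0 : Euc 2) 1) :
    ∃ f : K → ℝ × ℝ, Continuous f ∧ Function.Injective f := by
  have he : Continuous fun x ↦ (e x : Euc 2) := continuous_subtype_val.comp e.continuous
  refine ⟨fun x ↦ ((e x : Euc 2) 0, (e x : Euc 2) 1), by fun_prop, fun x y hxy ↦ ?_⟩
  rw [Prod.mk.injEq] at hxy
  refine e.injective (Subtype.ext ?_)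
  ext i
  fin_cases i
  · exact hxy.1
  · exact hxy.2

/-- Continuous stopping times: the identity away from a neighbourhood of `B`, and `0` on `B`. -/
theorem exists_stopping_time [CompactSpace K] [T2Space K] {B O : Set K} (hB : IsClosed B)
    (hO : IsOpen O) (hBO : B ⊆ O) : ∃ τ : C(K × I, I), (∀ x, τ (x, 0) = 0) ∧
      (∀ x ∈ B, ∀ t, τ (x, t) = 0) ∧ ∀ x ∉ O, ∀ t, τ (x, t) = t := by
  obtain ⟨χ, h0, h1, h01⟩ := exists_continuous_zero_one_of_isClosed hB hO.isClosed_compl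
    (disjoint_compl_right_iff_subset.2 hBO)
  refine ⟨⟨fun q ↦ min q.2 ⟨χ q.1, h01 q.1⟩, by fun_prop⟩, fun x ↦ ?_, fun x hx t ↦ ?_,
    fun x hx t ↦ ?_⟩
  · exact min_eq_left (h01 x).1
  · have hχ : (⟨χ x, h01 x⟩ : I) = 0 := Subtype.ext (h0 hx)
    change min t ⟨χ x, h01 x⟩ = 0
    rw [hχ]
    exact min_eq_right t.2.1
  · exact min_eq_left (show (t : ℝ) ≤ χ x by rw [h1 hx]; exact t.2.2)

/-- The open `N` serves for gluing, while the fibres of its closure are compact, as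
`exists_connecting_arcs` requires. -/
theorem exists_isOpen_closure_subset_of_diagonal [CompactSpace K] [T2Space K] {V : Set (K × K)}
    (hV : IsOpen V) (hd : ∀ x, (x, x) ∈ V) :
    ∃ N : Set (K × K), IsOpen N ∧ (∀ x, (x, x) ∈ N) ∧ closure N ⊆ V := by
  obtain ⟨N, hN, hdN, hNV⟩ := normal_exists_closure_subset (s := diagonal K) (t := V)
    isClosed_diagonal hV (fun p hp ↦ by
      obtain ⟨x, y⟩ := p
      obtain rfl : x = y := hp
      exact hd x)
  exact ⟨N, hN, fun x ↦ hdN (mem_diagonal x), hNV⟩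

end Disc

/-! ### Assembling the contraction -/

section Main

variable {M : Type*} [TopologicalSpace M] [ChartedSpace (Euc 3) M]
  [RiemannianBundle (fun x : M ↦ TangentSpace (𝓡 3) x)] {K : Type*} [TopologicalSpace K]

/-- A family of closed curves, each of which bounds a contraction by arcs of length at most `L`,
is contracted by a continuous family of arcs of length at most `5 * L + 10 * c`, provided that
the parameter space embeds into the plane. -/
theorem exists_arcs_of_pointwise_arcs [CompactSpace K] [T2Space K] {f : K → ℝ × ℝ}
    (hf : Continuous f) (hinj : Function.Injective f) {c : ℝ≥0}
    (hM : HasShortPaths c (univ : Set M)) {L : ℝ≥0} (F : C(K, C(I, M)))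
    {B : Set K} (hB : IsClosed B) (hFB : ∀ x ∈ B, IsConstantCurve (F x))
    (hα : ∀ x, ∃ α : C(I, C(I, M)), (∀ t, α t ∈ arcSpace M L) ∧ (∀ t, α t 0 = F x 0) ∧
      (∀ t, α t 1 = F x t) ∧ IsConstantCurve (α 0)) :
    ∃ H : C(K × I, C(I, M)), (∀ x t, H (x, t) ∈ arcSpace M (5 * L + 10 * c)) ∧
      (∀ x ∈ B, ∀ t, IsConstantCurve (H (x, t))) ∧
      (∀ x, H (x, 0) = ContinuousMap.const I (F x 0)) ∧
      (∀ x t, H (x, t) 0 = F x 0) ∧ ∀ x t, H (x, t) 1 = F x t := by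
  obtain ⟨W, G, hW, hWd, hGc, hGa, hG0, hGd, hG1⟩ := id hM
  replace hG1 : ∀ w ∈ W, G w 1 = w.2 := fun w hw ↦ hG1 w hw (mem_univ _)
  choose α hαL hα0 hα1 hαc using hα
  -- the connecting arcs near each point of the parameter space
  let V : Set (K × K) := {p | ∀ t, (F p.2 t, F p.1 t) ∈ W}
  have hV : IsOpen V := by
    have : V = {p : K × K | MapsTo
        (ContinuousMap.curry ⟨fun q : (K × K) × I ↦ (F q.1.2 q.2, F q.1.1 q.2), by fun_prop⟩ p)
        univ W} := by
      ext p
      simp [V, MapsTo]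
    rw [this]
    exact (ContinuousMap.isOpen_setOfPred_mapsTo isCompact_univ hW).preimage (ContinuousMap.continuous _)
  obtain ⟨N, hN, hNd, hNV⟩ := exists_isOpen_closure_subset_of_diagonal hV fun x t ↦ hWd _
  have hQ (ξ : K) := exists_connecting_arcs_of_near hGc hGa hG0 hG1 hM F (hαL ξ) (hα0 ξ) (hα1 ξ)
    (hαc ξ) (C := {x | (ξ, x) ∈ closure N})
    (isClosed_closure.preimage (Continuous.prodMk_right ξ)).isCompact fun x hx t ↦ hNV hx t
  choose Q hQc hQa hQb hQ0 hQ1 hQd using hQ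
  obtain ⟨ψ, U, ξ, hψ0, hψ1, hU, hψU, hξU, hξN⟩ := exists_three_coloring hf hinj hN hNd
  -- the arcs of each color
  let P : Fin 3 → K × I × I → C(I, M) := fun k ↦ gluedArcs F (U k) (ξ k) Q
  have hPc (k : Fin 3) {r r' : K × I → I} (hr : Continuous r) (hr' : Continuous r')
      (h : ∀ x ∉ U k, ∀ᶠ y in 𝓝 x, ∀ t, r (y, t) = r' (y, t)) :
      Continuous fun q : K × I ↦ P k (q.1, r q, r' q) :=
    continuous_gluedArcs F (hU k) (hξU k) hN (hξN k)
      (fun ξ ↦ (hQc ξ).mono (prod_mono_left fun x hx ↦ subset_closure hx))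
      (fun ξ x h r ↦ hQd ξ x (subset_closure h) r) hr hr' h
  have hP0 (k x r r') (h : x ∈ U k ∨ r = r') : P k (x, r, r') 0 = F x r := by
    by_cases hx : x ∈ U k
    · simp only [P, gluedArcs, if_pos hx, hQ0 _ _ (subset_closure (hξN k x hx))]
    · simp only [P, gluedArcs, if_neg hx, ContinuousMap.const_apply]
  have hP1 (k x r r') (h : x ∈ U k ∨ r = r') : P k (x, r, r') 1 = F x r' := by
    by_cases hx : x ∈ U k
    · simp only [P, gluedArcs, if_pos hx, hQ1 _ _ (subset_closure (hξN k x hx))]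
    · simp only [P, gluedArcs, if_neg hx, ContinuousMap.const_apply, h.resolve_left hx]
  have hPd (k x r) : P k (x, r, r) = ContinuousMap.const I (F x r) := by
    by_cases hx : x ∈ U k
    · simp only [P, gluedArcs, if_pos hx, hQd _ _ (subset_closure (hξN k x hx))]
    · simp only [P, gluedArcs, if_neg hx]
  have hPa (k x r r') : P k (x, r, r') ∈ arcSpace M (2 * L + 3 * c) := by
    by_cases hx : x ∈ U k
    · simp only [P, gluedArcs, if_pos hx, hQa _ _ (subset_closure (hξN k x hx))]
    · simp only [P, gluedArcs, if_neg hx, const_mem_arcSpace]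
  have hPb (k x r) : P k (x, 0, r) ∈ arcSpace M (L + 3 * c) := by
    by_cases hx : x ∈ U k
    · simp only [P, gluedArcs, if_pos hx, hQb _ _ (subset_closure (hξN k x hx))]
    · simp only [P, gluedArcs, if_neg hx, const_mem_arcSpace]
  -- the stopping time that makes the family constant near `B`
  let O : Set K := {x | ∀ s t, (F x s, F x t) ∈ W}
  have hO : IsOpen O := by
    have : O = {x : K | MapsTo
        (ContinuousMap.curry ⟨fun q : K × (I × I) ↦ (F q.1 q.2.1, F q.1 q.2.2), by fun_prop⟩ x)
        univ W} := by
      ext p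
      simp [O, MapsTo]
    rw [this]
    exact (ContinuousMap.isOpen_setOfPred_mapsTo isCompact_univ hW).preimage (ContinuousMap.continuous _)
  have hBO : B ⊆ O := by
    intro x hx s t
    obtain ⟨p, hp⟩ := hFB x hx
    simpa [hp] using hWd p
  obtain ⟨τ, hτ0, hτB, hτO⟩ := exists_stopping_time hB hO hBO
  have hτW (q : K × I) : (F q.1 (τ q), F q.1 q.2) ∈ W := by
    by_cases hq : q.1 ∈ O
    · exact hq _ _
    · rw [show τ q = q.2 from hτO q.1 hq q.2]
      exact hWd _
  -- the subdivision of `[0, τ]`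
  let S : (K → ℝ) → K × I → I := fun ρ q ↦ projIcc 0 1 zero_le_one (min (τ q) (ρ q.1))
  have hS {ρ : K → ℝ} (hρ : Continuous ρ) : Continuous (S ρ) := by fun_prop
  have hSτ (ρ : K → ℝ) (q) (h : 0 ≤ ρ q.1) (hq : τ q = 0) : S ρ q = 0 := by
    simp only [S, hq]
    exact projIcc_of_le_left _ (min_le_left _ _)
  let ρ₁ : K → ℝ := fun x ↦ ψ 0 x
  let ρ₂ : K → ℝ := fun x ↦ ψ 0 x + ψ 1 x
  have hρ₁ : Continuous ρ₁ := by fun_prop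
  have hρ₂ : Continuous ρ₂ := by fun_prop
  -- Some `ψ k` is at least 1, so the three parts exhaust `[0, τ]`; the `ψ k` need no normalization.
  have hτρ (q : K × I) : S (fun x ↦ ψ 0 x + ψ 1 x + ψ 2 x) q = τ q := by
    have : (1 : ℝ) ≤ ψ 0 q.1 + ψ 1 q.1 + ψ 2 q.1 := by
      obtain ⟨k, hk⟩ := hψ1 q.1
      have h0 := hψ0 0 q.1
      have h1 := hψ0 1 q.1
      have h2 := hψ0 2 q.1
      fin_cases k <;> simp at hk <;> linarith
    simp only [S, min_eq_left ((τ q).2.2.trans this), projIcc_val]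
  -- Where `ψ k` vanishes locally, the part of colour `k` is degenerate.
  have e₁ (x) (hx : x ∉ U 0) : ∀ᶠ y in 𝓝 x, ∀ t, (0 : I) = S ρ₁ (y, t) := by
    filter_upwards [hψU 0 x hx] with y hy t
    simp only [S, ρ₁, hy, min_eq_right (τ (y, t)).2.1]
    exact (projIcc_left _).symm
  have e₂ (x) (hx : x ∉ U 1) : ∀ᶠ y in 𝓝 x, ∀ t, S ρ₁ (y, t) = S ρ₂ (y, t) := by
    filter_upwards [hψU 1 x hx] with y hy t
    simp only [S, ρ₁, ρ₂, hy, add_zero]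
  have e₃ (x) (hx : x ∉ U 2) : ∀ᶠ y in 𝓝 x, ∀ t, S ρ₂ (y, t) = τ (y, t) := by
    filter_upwards [hψU 2 x hx] with y hy t
    rw [← hτρ]
    simp only [S, ρ₂, hy, add_zero]
  -- the four parts of the arcs
  let A₁ : K × I → C(I, M) := fun q ↦ P 0 (q.1, 0, S ρ₁ q)
  let A₂ : K × I → C(I, M) := fun q ↦ P 1 (q.1, S ρ₁ q, S ρ₂ q)
  let A₃ : K × I → C(I, M) := fun q ↦ P 2 (q.1, S ρ₂ q, τ q)
  let A₄ : K × I → C(I, M) := fun q ↦ G (F q.1 (τ q), F q.1 q.2)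
  have c₁ : Continuous A₁ := hPc 0 continuous_const (hS hρ₁) e₁
  have c₂ : Continuous A₂ := hPc 1 (hS hρ₁) (hS hρ₂) e₂
  have c₃ : Continuous A₃ := hPc 2 (hS hρ₂) τ.continuous e₃
  have c₄ : Continuous A₄ := hGc.comp_continuous (by fun_prop) hτW
  have or₁ (q : K × I) : q.1 ∈ U 0 ∨ 0 = S ρ₁ q :=
    or_iff_not_imp_left.2 fun h ↦ (e₁ q.1 h).self_of_nhds q.2
  have or₂ (q : K × I) : q.1 ∈ U 1 ∨ S ρ₁ q = S ρ₂ q :=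
    or_iff_not_imp_left.2 fun h ↦ (e₂ q.1 h).self_of_nhds q.2
  have or₃ (q : K × I) : q.1 ∈ U 2 ∨ S ρ₂ q = τ q :=
    or_iff_not_imp_left.2 fun h ↦ (e₃ q.1 h).self_of_nhds q.2
  have m₃ (q) : A₃ q 1 = A₄ q 0 := by simp only [A₃, A₄, hP1 _ _ _ _ (or₃ q), hG0 _ (hτW q)]
  have m₂ (q) : A₂ q 1 = curveConcat (A₃ q) (A₄ q) 0 := by
    rw [curveConcat_zero (m₃ q)]
    simp only [A₂, A₃, hP1 _ _ _ _ (or₂ q), hP0 _ _ _ _ (or₃ q)]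
  have m₁ (q) : A₁ q 1 = curveConcat (A₂ q) (curveConcat (A₃ q) (A₄ q)) 0 := by
    rw [curveConcat_zero (m₂ q)]
    simp only [A₁, A₂, hP1 _ _ _ _ (or₁ q), hP0 _ _ _ _ (or₂ q)]
  let H : C(K × I, C(I, M)) :=
    ⟨fun q ↦ curveConcat (A₁ q) (curveConcat (A₂ q) (curveConcat (A₃ q) (A₄ q))),
      c₁.curveConcat (c₂.curveConcat (c₃.curveConcat c₄ m₃) m₂) m₁⟩
  have hHτ (q : K × I) (hq : τ q = 0) (hq' : F q.1 q.2 = F q.1 0) :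
      H q = ContinuousMap.const I (F q.1 0) := by
    have s₁ : S ρ₁ q = 0 := hSτ _ q (hψ0 0 q.1) hq
    have s₂ : S ρ₂ q = 0 := hSτ _ q (add_nonneg (hψ0 0 q.1) (hψ0 1 q.1)) hq
    simp only [H, ContinuousMap.coe_mk, A₁, A₂, A₃, A₄, s₁, s₂, hq, hq', hPd, hGd,
      curveConcat_const]
  refine ⟨H, fun x t ↦ ?_, fun x hx t ↦ ⟨F x 0, hHτ (x, t) (hτB x hx t) ?_⟩,
    fun x ↦ hHτ (x, 0) (hτ0 x) rfl, fun x t ↦ ?_, fun x t ↦ ?_⟩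
  -- The total is `(L + 3c) + (2L + 3c) + (2L + 3c) + c`; only the first part starts at parameter 0.
  · have := curveConcat_mem_arcSpace (hPb 0 x (S ρ₁ (x, t))) (curveConcat_mem_arcSpace
      (hPa 1 x (S ρ₁ (x, t)) (S ρ₂ (x, t))) (curveConcat_mem_arcSpace
      (hPa 2 x (S ρ₂ (x, t)) (τ (x, t))) (hGa _ (hτW (x, t))) (m₃ (x, t)))
      (m₂ (x, t))) (m₁ (x, t))
    exact arcSpace_mono (le_of_eq (by ring)) this
  · obtain ⟨p, hp⟩ := hFB x hx
    simp [hp]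
  · change curveConcat (A₁ (x, t)) _ 0 = _
    rw [curveConcat_zero (m₁ _)]
    exact hP0 _ _ _ _ (or₁ (x, t))
  · change curveConcat (A₁ (x, t)) _ 1 = _
    rw [curveConcat_one (m₁ _), curveConcat_one (m₂ _), curveConcat_one (m₃ _)]
    exact hG1 _ (hτW (x, t))

end Main

theorem mainTheorem6
    {M : Type*} [TopologicalSpace M] [T2Space M] [CompactSpace M]
    [ChartedSpace (Euc 3) M] [IsManifold (𝓡 3) ∞ M]
    [RiemannianBundle (fun x : M ↦ TangentSpace (𝓡 3) x)]
    [IsContMDiffRiemannianBundle (𝓡 3) ∞ (Euc 3) (fun x : M ↦ TangentSpace (𝓡 3) x)]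
    {K : Type*} [TopologicalSpace K] (e : K ≃ₜ Metric.closedBall (0 : Euc 2) 1)
    (L : ℝ≥0) (F : C(K, C(I, M)))
    (hF : ∀ x, F x ∈ loopSpace M)
    (hF_bdry : ∀ x ∈ discBoundary e, IsConstantCurve (F x))
    (hF_short : ∀ x, ∃ S : Set M, IsEmbeddedTwoSphere S ∧ IsLShort L S ∧ range (F x) ⊆ S)
    (δ : ℝ≥0) (hδ : 0 < δ) :
    ∃ H : C(K × I, C(I, M)),
      (∀ x t, H (x, t) ∈ arcSpace M (5 * L + δ)) ∧
      (∀ x ∈ discBoundary e, ∀ t, IsConstantCurve (H (x, t))) ∧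
      (∀ x, H (x, 0) = ContinuousMap.const I (F x 0)) ∧
      (∀ x t, H (x, t) 0 = F x 0 ∧ H (x, t) 1 = F x t) ∧
      (∀ x, H (x, 1) ∈ loopSpace M) ∧
      ContinuousMap.HomotopicWith F
        (H.comp ((ContinuousMap.id K).prodMk (ContinuousMap.const K 1)))
        (fun G ↦ (∀ x, G x ∈ loopSpace M) ∧ ∀ x ∈ discBoundary e, G x = F x) := by
  have : IsContinuousRiemannianBundle (Euc 3) (fun x : M ↦ TangentSpace (𝓡 3) x) := by
    obtain ⟨g, hg, hg'⟩ := IsContMDiffRiemannianBundle.exists_contMDiff (IB := 𝓡 3) (n := ∞)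
      (F := Euc 3) (E := fun x : M ↦ TangentSpace (𝓡 3) x)
    exact ⟨g, hg.continuous, hg'⟩
  have : CompactSpace K := e.symm.compactSpace
  have : T2Space K := e.symm.t2Space
  obtain ⟨f, hf, hinj⟩ := exists_continuous_injective_of_disc e
  -- The choice `c = δ / 10` turns the error `10 * c` into `δ`.
  obtain ⟨H, hHa, hHB, hH00, hH0, hH1⟩ := exists_arcs_of_pointwise_arcs hf hinj
    (hasShortPaths_univ (M := M) (c := δ / 10) (by positivity)) (L := L) F
    (isClosed_discBoundary e) hF_bdry fun x ↦ by
      obtain ⟨S, -, hS, hFS⟩ := hF_short x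
      obtain ⟨α, hα, hα0, hα1, hαc, -⟩ := hS (F x) (hF x) hFS
      exact ⟨α, hα, hα0, hα1, hαc⟩
  have hH (x t) : IsPiecewiseContMDiff 1 (H (x, t)) := (hHa x t).1.of_le le_top
  refine ⟨H, fun x t ↦ arcSpace_mono (le_of_eq ?_) (hHa x t), hHB, hH00,
    fun x t ↦ ⟨hH0 x t, hH1 x t⟩, fun x ↦ ⟨?_, hH x 1⟩,
    homotopicWith_of_arcs hF hF_bdry hH hHB hH00 hH0 hH1⟩
  · rw [mul_div_cancel₀ _ (by norm_num)]
  · rw [hH0, hH1, (hF x).1]
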